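/- Let $k\ge 1$ and $n_1,\dots,n_k\ge 1$ be integers, and let $\mathbb F_{n}^+$ be the free monoid on $g_1,\dots,g_n$, with length $|\cdot|$. For each $i$ let $q_i=\sum_{\alpha\in\mathbb F_{n_i}^+}a_{i,\alpha}Z_\alpha$ be a positive regular noncommutative polynomial in $n_i$ indeterminates: finitely many nonzero terms, all $a_{i,\alpha}\ge 0$, zero constant term, and $a_{i,g_j}\neq 0$ for all $j$. Put $b_{i,1}:=1$ for the empty word and, for $|\alpha|\ge 1$, $$b_{i,\alpha}:=\sum_{p=1}^{|\alpha|}\ \sum_{\gamma_1\cdots\gamma_p=\alpha,\ |\gamma_j|\ge 1} a_{i,\gamma_1}\cdots a_{i,\gamma_p}.$$ For a complex Hilbert space $\mathcal H$ let $B(\mathcal H)^{n_1}\times_c\cdots\times_c B(\mathcal H)^{n_k}$ be the set of tuples $\mathbf X=(X_1,\dots,X_k)$, $X_i=(X_{i,1},\dots,X_{i,n_i})\in B(\mathcal H)^{n_i}$, such that the entries of $X_s$ commute with those of $X_t$ for $s\ne t$. For a word $\alpha=g_{j_1}\cdots g_{j_p}$ put $X_{i,\alpha}:=X_{i,j_1}\cdots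 X_{i,j_p}$, and let $\Phi_{q_i,X_i}(T):=\sum_\alpha a_{i,\alpha}X_{i,\alpha}TX_{i,\alpha}^*$ for $T\in B(\mathcal H)$. For $\mathbf p\in\{0,1\}^k$ let $$\mathbf\Delta^{\mathbf p}_{\mathbf q,\mathbf X}:=(\mathrm{id}-\Phi_{q_1,X_1})^{p_1}\circ\cdots\circ(\mathrm{id}-\Phi_{q_k,X_k})^{p_k}.$$ The regular polydomain $\mathbf D_{\mathbf q}(\mathcal H)$ is the set of all $\mathbf X\in B(\mathcal H)^{n_1}\times_c\cdots\times_c B(\mathcal H)^{n_k}$ such that $\mathbf\Delta^{\mathbf p}_{\mathbf q,\mathbf X}(I)\ge 0$ for every $\mathbf p\in\{0,1\}^k$ and $\mathbf\Delta^{(1,\dots,1)}_{\mathbf q,\mathbf X}(I)$ is positive and invertible; $\mathbf D_{\mathbf q}(\mathcal H)^-$ is its closure in the operator norm topology. We put $\infty\,\mathbf D_{\mathbf q}(\mathcal H):=\bigcup_{\rho>0}\rho\,\mathbf D_{\mathbf q}(\mathcal H)=B(\mathcal H)^{n_1}\times_c\cdots\times_c B(\mathcal H)^{n_k}$. For $\mathbf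 p=(p_1,\dots,p_k)\in\mathbb Z_+^k$ let $|\mathbf p|=p_1+\cdots+p_k$ and let $\Lambda_{\mathbf p}$ be the set of $\boldsymbol\alpha=(\alpha_1,\dots,\alpha_k)\in\mathbb F_{n_1}^+\times\cdots\times\mathbb F_{n_k}^+$ with $|\alpha_i|=p_i$ for all $i$. Write $\mathbf X_{\boldsymbol\alpha}:=X_{1,\alpha_1}\cdots X_{k,\alpha_k}$ and $b_{\boldsymbol\alpha}:=b_{1,\alpha_1}\cdots b_{k,\alpha_k}$. **Theorem (Hadamard formula).** Let $\mathcal K$ be a complex Hilbert space and let $\psi=\sum_{\boldsymbol\alpha}A_{(\boldsymbol\alpha)}\otimes\mathbf Z_{\boldsymbol\alpha}$ be a formal power series with coefficients $A_{(\boldsymbol\alpha)}\in B(\mathcal K)$, $\boldsymbol\alpha\in\mathbb F_{n_1}^+\times\cdots\times\mathbb F_{n_k}^+$. Define $\gamma\in[0,\infty]$ by $$\frac1\gamma=\limsup_{\mathbf p\in\mathbb Z_+^k}\Big\|\sum_{\boldsymbol\alpha\in\Lambda_{\mathbf p}}\frac1{b_{\boldsymbol\alpha}}A_{(\boldsymbol\alpha)}^*A_{(\boldsymbol\alpha)}\Big\|^{\frac1{2|\mathbf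 p|}},$$ where the limsup is along the filter of complements of finite subsets of $\mathbb Z_+^k$, and $1/0=\infty$, $1/\infty=0$. Then: (i) For every Hilbert space $\mathcal H$ and every $\mathbf X\in\gamma\mathbf D_{\mathbf q}(\mathcal H)$ the series $\sum_{\mathbf p\in\mathbb Z_+^k}\big\|\sum_{\boldsymbol\alpha\in\Lambda_{\mathbf p}}A_{(\boldsymbol\alpha)}\otimes\mathbf X_{\boldsymbol\alpha}\big\|$ (operator norms on the Hilbert tensor product $\mathcal K\otimes\mathcal H$) converges, and the convergence is uniform on $r\mathbf D_{\mathbf q}(\mathcal H)^-$ whenever $0\le r<\gamma$. (ii) If $\gamma<\infty$ and $\gamma<s<\infty$, then there are a Hilbert space $\mathcal H$ and $\mathbf Y\in s\mathbf D_{\mathbf q}(\mathcal H)^-$ such that the series $\sum_{\mathbf p\in\mathbb Z_+^k}\sum_{\boldsymbol\alpha\in\Lambda_{\mathbf p}}A_{(\boldsymbol\alpha)}\otimes\mathbf Y_{\boldsymbol\alpha}$ diverges in the operator norm topology, whatever the way of summation: for no sequence $(F_N)$ of finite subsets of $\mathbb Z_+^k$ that eventually contains every given finite subset do the partial sums over $F_N$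 converge in norm. -/

import Mathlib

open scoped ENNReal NNReal TensorProduct Pointwise

universe u v

noncomputable section

namespace Polydomain

/-- A positive regular polynomial in `n` noncommuting indeterminates: a polynomial (an element of
the monoid algebra of the free monoid on `n` generators) whose coefficients are nonnegative real
numbers, whose constant term is zero, and whose linear terms all have nonzero coefficient. -/
structure IsPositiveRegular {n : ℕ} (q : MonoidAlgebra ℝ (FreeMonoid (Fin n))) : Prop where
  nonneg : ∀ α, 0 ≤ q.coeff α
  const_eq_zero : q.coeff 1 = 0
  linear_ne_zero : ∀ j, q.coeff (FreeMonoid.of j) ≠ 0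

/-- The coefficient `b_α = ∑_p ∑_{γ₁ ⋯ γ_p = α} a_{γ₁} ⋯ a_{γ_p}`, the sum being over all the ways
of writing the word `α` as a product of nonempty words `γ₁, …, γ_p`; these correspond to the
compositions of the length of `α`. The empty word has one (empty) factorization, so `b_1 = 1`. -/
def weight {n : ℕ} (q : MonoidAlgebra ℝ (FreeMonoid (Fin n))) (α : FreeMonoid (Fin n)) : ℝ :=
  ∑ c : Composition α.toList.length,
    ((α.toList.splitWrtComposition c).map fun γ => q.coeff (FreeMonoid.ofList γ)).prod

/-- The finite set of words of length `p` in `n` letters. -/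
def words (n p : ℕ) : Finset (FreeMonoid (Fin n)) :=
  Finset.univ.map ⟨fun f : Fin p → Fin n => FreeMonoid.ofList (List.ofFn f),
    fun _ _ h => List.ofFn_injective (FreeMonoid.ofList.injective h)⟩

theorem mem_words {n p : ℕ} {α : FreeMonoid (Fin n)} : α ∈ words n p ↔ α.length = p := by
  constructor
  · intro h
    obtain ⟨f, -, rfl⟩ := Finset.mem_map.1 h
    exact List.length_ofFn
  · rintro rfl
    exact Finset.mem_map.2 ⟨α.toList.get, Finset.mem_univ _, List.ofFn_get _⟩

variable {k : ℕ} {n : Fin k → ℕ}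

/-- The finite set `Λ_p` of the `k`-tuples of words `(α₁, …, α_k)` with `|α_i| = p_i`. -/
def multiWords (n : Fin k → ℕ) (p : Fin k → ℕ) : Finset (∀ i, FreeMonoid (Fin (n i))) :=
  Fintype.piFinset fun i => words (n i) (p i)

theorem mem_multiWords {p : Fin k → ℕ} {α : ∀ i, FreeMonoid (Fin (n i))} :
    α ∈ multiWords n p ↔ ∀ i, (α i).length = p i := by
  simp [multiWords, mem_words]

/-- The product set `B(H)^{n₁} × ⋯ × B(H)^{n_k}`, with the product of the norm topologies. -/
abbrev OpTuple (n : Fin k → ℕ) (H : Type*) [NormedAddCommGroup H] [InnerProductSpace ℂ H] :=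
  ∀ i, Fin (n i) → (H →L[ℂ] H)

section Operators

variable {H : Type*} [NormedAddCommGroup H] [InnerProductSpace ℂ H]

/-- Entries of different components commute. -/
def CrossCommute (X : OpTuple n H) : Prop :=
  ∀ s t, s ≠ t → ∀ a b, Commute (X s a) (X t b)

/-- `T_α = T_{j₁} ⋯ T_{j_p}` for the word `α = g_{j₁} ⋯ g_{j_p}`. -/
def evalWord {m : ℕ} (T : Fin m → (H →L[ℂ] H)) (α : FreeMonoid (Fin m)) : H →L[ℂ] H :=
  FreeMonoid.lift T α

/-- `X_α = X_{1,α₁} ⋯ X_{k,α_k}`, in this order. -/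
def evalMultiWord (X : OpTuple n H) (α : ∀ i, FreeMonoid (Fin (n i))) : H →L[ℂ] H :=
  (List.ofFn fun i => evalWord (X i) (α i)).prod

variable [CompleteSpace H]

/-- The linear map `Y ↦ T Y T^*` on `B(H)`. -/
def conj (T : H →L[ℂ] H) : Module.End ℂ (H →L[ℂ] H) :=
  LinearMap.mulLeft ℂ T ∘ₗ LinearMap.mulRight ℂ (star T)

/-- The map `Φ_{q,T}(Y) = ∑_α a_α T_α Y T_α^*` on `B(H)`, where `q = ∑_α a_α Z_α`. -/
def Phi {m : ℕ} (q : MonoidAlgebra ℝ (FreeMonoid (Fin m))) (T : Fin m → (H →L[ℂ] H)) :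
    Module.End ℂ (H →L[ℂ] H) :=
  ∑ α ∈ q.coeff.support, ((q.coeff α : ℝ) : ℂ) • conj (evalWord T α)

/-- The defect mapping `(id - Φ_{q₁,X₁})^{p₁} ∘ ⋯ ∘ (id - Φ_{q_k,X_k})^{p_k}`. -/
def defect (q : ∀ i, MonoidAlgebra ℝ (FreeMonoid (Fin (n i)))) (X : OpTuple n H)
    (p : Fin k → ℕ) : Module.End ℂ (H →L[ℂ] H) :=
  (List.ofFn fun i => (1 - Phi (q i) (X i)) ^ p i).prod

end Operators

section Domains

variable (q : ∀ i, MonoidAlgebra ℝ (FreeMonoid (Fin (n i))))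
  (H : Type*) [NormedAddCommGroup H] [InnerProductSpace ℂ H] [CompleteSpace H]

/-- The set of the `X` with cross-commuting components such that `Δ^p_{q,X}(I) ≥ 0` for all
`p ∈ {0,1}^k`. -/
def closedPolydomain : Set (OpTuple n H) :=
  {X | CrossCommute X ∧ ∀ p : Fin k → ℕ, (∀ i, p i ≤ 1) → (defect q X p 1).IsPositive}

/-- The regular polydomain `D_q(H)`: the `X` in the set above for which `Δ_{q,X}(I)` is moreover
(positive and) invertible. -/
def openPolydomain : Set (OpTuple n H) :=
  {X | X ∈ closedPolydomain q H ∧ IsUnit (defect q X (fun _ => 1) 1)}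

open Classical in
/-- The polydomain `γ D_q(H)` of radius `γ ∈ [0,∞]`; for `γ = ∞` it is the set of all the tuples
with cross-commuting components, which is the union of all the `ρ D_q(H)`, `0 < ρ < ∞`. -/
def polydomainOfRadius (γ : ℝ≥0∞) : Set (OpTuple n H) :=
  if γ = ⊤ then {X | CrossCommute X} else (γ.toReal : ℂ) • openPolydomain q H

end Domains

section Tensor

variable {K H : Type*} [NormedAddCommGroup K] [InnerProductSpace ℂ K]
  [NormedAddCommGroup H] [InnerProductSpace ℂ H]

/-- The Hilbert space tensor product: the completion of the algebraic tensor product with respect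
to the inner product determined by `⟪x ⊗ y, x' ⊗ y'⟫ = ⟪x, x'⟫ ⟪y, y'⟫`. -/
abbrev HilbertTensor (K H : Type*) [NormedAddCommGroup K] [InnerProductSpace ℂ K]
    [NormedAddCommGroup H] [InnerProductSpace ℂ H] :=
  UniformSpace.Completion (K ⊗[ℂ] H)

/-- The operator `A ⊗ X` on the Hilbert tensor product, the continuous extension of
`x ⊗ y ↦ A x ⊗ X y`. -/
def opTensor (A : K →L[ℂ] K) (X : H →L[ℂ] H) : HilbertTensor K H →L[ℂ] HilbertTensor K H :=
  ((UniformSpace.Completion.toComplL : K ⊗[ℂ] H →L[ℂ] HilbertTensor K H) ∘L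
    TensorProduct.mapL A X).extend UniformSpace.Completion.toComplL

theorem opTensor_coe (A : K →L[ℂ] K) (X : H →L[ℂ] H) (z : K ⊗[ℂ] H) :
    opTensor A X (z : HilbertTensor K H) =
      ((TensorProduct.mapL A X z : K ⊗[ℂ] H) : HilbertTensor K H) :=
  ContinuousLinearMap.extend_eq _ (e := UniformSpace.Completion.toComplL)
    UniformSpace.Completion.denseRange_coe
    (UniformSpace.Completion.isUniformInducing_coe _) z

theorem opTensor_tmul (A : K →L[ℂ] K) (X : H →L[ℂ] H) (x : K) (y : H) :
    opTensor A X ((x ⊗ₜ[ℂ] y : K ⊗[ℂ] H) : HilbertTensor K H) =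
      ((A x ⊗ₜ[ℂ] X y : K ⊗[ℂ] H) : HilbertTensor K H) :=
  opTensor_coe A X _

/-- The homogeneous part `∑_{α ∈ Λ_p} A_α ⊗ X_α` of multidegree `p` of the formal power series
`∑_α A_α ⊗ Z_α`, evaluated at `X`. -/
def homogeneousPart (A : (∀ i, FreeMonoid (Fin (n i))) → (K →L[ℂ] K)) (X : OpTuple n H)
    (p : Fin k → ℕ) : HilbertTensor K H →L[ℂ] HilbertTensor K H :=
  ∑ α ∈ multiWords n p, opTensor (A α) (evalMultiWord X α)

/-- The operator `∑_{α ∈ Λ_p} (b_{1,α₁} ⋯ b_{k,α_k})⁻¹ A_α^* A_α`. -/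
def coeffGram [CompleteSpace K] (q : ∀ i, MonoidAlgebra ℝ (FreeMonoid (Fin (n i))))
    (A : (∀ i, FreeMonoid (Fin (n i))) → (K →L[ℂ] K)) (p : Fin k → ℕ) : K →L[ℂ] K :=
  ∑ α ∈ multiWords n p, (((∏ i, weight (q i) (α i))⁻¹ : ℝ) : ℂ) • (star (A α) * A α)

end Tensor

end Polydomain

end

/-! The weights b_α are the coefficients of the series 1/(1 - q_i), so b_β is the sum of a_α b_δ
over the factorizations β = αδ with α nonempty, for β ≠ 1. Both halves rest on this recursion,
`weight_eq_sum_take`.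

Convergence: if Φ_{q_i,X_i}(I) ≤ I for every i, iterating the recursion gives ∑ b_α X_α X_α^* ≤ I
over each Λ_p (`sum_multiWords_le_one`). Since A_α ⊗ X_α = (I ⊗ √b_α X_α)(A_α/√b_α ⊗ I),
Cauchy–Schwarz for a row times a column bounds the homogeneous part of multidegree p by √‖G_p‖,
where G_p is `coeffGram` (`norm_homogeneousPart_le`). By homogeneity the bound at rX is r^|p|
√‖G_p‖, which is summable for r < γ by the root test (`summable_pow_mul_sqrt`). Points of γD, for γ
> 0, have the form rY with r < γ and Φ_{q_i,Y_i}(I) ≤ I, because an invertible defect forces ‖Φ(I)‖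
< 1 and so leaves room to stretch (`exists_smul_of_mem_polydomainOfRadius`).

Divergence: the universal model consists of the weighted left shifts e_β ↦ √(b_β/b_{αβ}) e_{αβ} on
ℓ² of the product of the free monoids. At r times the model the defects are diagonal, and the
recursion bounds each of their factors below by 1 - r²; so r times the model lies in D for r < 1.
The model sends e_1 to orthogonal vectors b_α^{-1/2} e_α, hence a partial sum over F at s times the
model has norm at least s^|p| √‖G_p‖ for every p in F (`norm_coeffGram_le`). Norm convergence would
bound these quantities uniformly and force s ≤ γ. -/

namespace Polydomain

/-! ### The weights b_α and their recursion -/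

section Weight

/-- The sum over all the compositions of `m + 1` splits according to the first block. -/
theorem sum_composition_succ {M : Type*} [AddCommMonoid M] (m : ℕ) (F : List ℕ → M) :
    ∑ c : Composition (m + 1), F c.blocks =
      ∑ i : Fin (m + 1), ∑ c : Composition (m - i), F ((i + 1 : ℕ) :: c.blocks) := by
  rw [Finset.sum_sigma' Finset.univ (fun _ => Finset.univ)
    (fun (i : Fin (m + 1)) (c : Composition (m - i)) => F ((i + 1 : ℕ) :: c.blocks))]
  symm
  refine Finset.sum_bij (fun (x : (i : Fin (m + 1)) × Composition (m - i)) _ =>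
    (⟨(x.1 + 1 : ℕ) :: x.2.blocks, ?_, ?_⟩ : Composition (m + 1))) ?_ ?_ ?_ ?_
  · intro i hi
    rcases List.mem_cons.1 hi with rfl | hi
    · omega
    · exact x.2.blocks_pos hi
  · have := x.1.2
    simp only [List.sum_cons, x.2.blocks_sum]
    omega
  · simp
  · rintro ⟨i, c⟩ - ⟨j, d⟩ - h
    have h' := congrArg Composition.blocks h
    simp only [List.cons.injEq, add_left_inj] at h'
    obtain rfl : i = j := Fin.ext h'.1
    obtain rfl : c = d := Composition.ext h'.2
    rfl
  · intro c _
    obtain ⟨bl, hpos, hsum⟩ := c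
    cases bl with
    | nil => simp at hsum
    | cons b bs =>
      have hb : 0 < b := hpos (by simp)
      rw [List.sum_cons] at hsum
      refine ⟨⟨⟨b - 1, by omega⟩, ⟨bs, fun h => hpos (List.mem_cons_of_mem _ h), ?_⟩⟩,
        Finset.mem_univ _, ?_⟩
      · simp only; omega
      · apply Composition.ext
        simp only [List.cons.injEq, and_true]
        omega
  · intros; rfl

variable {n : ℕ} (q : MonoidAlgebra ℝ (FreeMonoid (Fin n)))

/-- The sum over the compositions of `m` of the products of coefficients along the blocks. -/
def listWeight (m : ℕ) (l : List (Fin n)) : ℝ :=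
  ∑ c : Composition m,
    ((l.splitWrtCompositionAux c.blocks).map fun γ => q.coeff (FreeMonoid.ofList γ)).prod

theorem weight_ofList (l : List (Fin n)) :
    weight q (FreeMonoid.ofList l) = listWeight q l.length l := rfl

/-- Keeping the composed number m independent of the length of l avoids transport between the types
`Composition m` when a block is removed. -/
theorem listWeight_succ (m : ℕ) (l : List (Fin n)) :
    listWeight q (m + 1) l = ∑ i ∈ Finset.range (m + 1),
      q.coeff (FreeMonoid.ofList (l.take (i + 1))) * listWeight q (m - i) (l.drop (i + 1)) := by
  rw [listWeight, sum_composition_succ m fun b =>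
    ((l.splitWrtCompositionAux b).map fun γ => q.coeff (FreeMonoid.ofList γ)).prod,
    Finset.sum_range]
  refine Finset.sum_congr rfl fun i _ => ?_
  rw [listWeight, Finset.mul_sum]
  refine Finset.sum_congr rfl fun c _ => ?_
  rw [List.splitWrtCompositionAux_cons, List.map_cons, List.prod_cons]

theorem weight_one : weight q 1 = 1 := by
  have : Fintype.card (Composition 0) = 1 := by rw [composition_card]; rfl
  obtain ⟨c, hc⟩ := Fintype.card_eq_one_iff.1 this
  change listWeight q 0 [] = 1
  rw [listWeight, Fintype.sum_eq_single c (fun d hd => absurd (hc d) hd)]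
  have : c.blocks = [] := by
    rw [← List.length_eq_zero_iff]
    exact Nat.le_zero.1 c.length_le
  rw [this]
  simp [List.splitWrtCompositionAux]

/-- The recursion for the weights, splitting off the first factor. -/
theorem weight_eq_sum_take {l : List (Fin n)} (hl : l ≠ []) :
    weight q (FreeMonoid.ofList l) = ∑ i ∈ Finset.range l.length,
      q.coeff (FreeMonoid.ofList (l.take (i + 1))) *
        weight q (FreeMonoid.ofList (l.drop (i + 1))) := by
  obtain ⟨m, hm⟩ : ∃ m, l.length = m + 1 :=
    Nat.exists_eq_succ_of_ne_zero (by simpa using hl)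
  rw [weight_ofList, hm, listWeight_succ]
  refine Finset.sum_congr rfl fun i _ => ?_
  rw [weight_ofList, List.length_drop, hm, Nat.add_sub_add_right]

variable {q}

theorem weight_nonneg (hq : IsPositiveRegular q) (α : FreeMonoid (Fin n)) : 0 ≤ weight q α := by
  refine Finset.sum_nonneg fun c _ => List.prod_nonneg fun x hx => ?_
  obtain ⟨γ, -, rfl⟩ := List.mem_map.1 hx
  exact hq.nonneg _

/-- One term of the recursion is at most the weight. -/
theorem coeff_mul_weight_le (hq : IsPositiveRegular q) (α β : FreeMonoid (Fin n)) :
    q.coeff α * weight q β ≤ weight q (α * β) := by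
  by_cases hα : α = 1
  · rw [hα, hq.const_eq_zero, zero_mul]
    exact weight_nonneg hq _
  have hα' : α.toList ≠ [] := hα
  have hpos := List.length_pos_iff.2 hα'
  have h := weight_eq_sum_take q (l := α.toList ++ β.toList) (by simp [hα'])
  change weight q (α * β) = _ at h
  rw [h]
  -- Index i stands for a first factor of length i + 1, so α itself is the term of index |α| - 1.
  have hmem : α.toList.length - 1 ∈ Finset.range (α.toList ++ β.toList).length := by
    rw [Finset.mem_range, List.length_append]; omega
  refine le_trans (le_of_eq ?_) (Finset.single_le_sum (fun i _ =>
    mul_nonneg (hq.nonneg _) (weight_nonneg hq _)) hmem)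
  rw [Nat.sub_add_cancel hpos, List.take_left, List.drop_left]
  rfl

/-- The factorization into single letters already contributes a positive term, the linear
coefficients being nonzero. -/
theorem weight_pos (hq : IsPositiveRegular q) (α : FreeMonoid (Fin n)) : 0 < weight q α := by
  induction α using FreeMonoid.recOn with
  | one => rw [weight_one]; exact one_pos
  | of_mul j α ih =>
    exact (mul_pos ((hq.nonneg _).lt_of_ne' (hq.linear_ne_zero j)) ih).trans_le
      (coeff_mul_weight_le hq _ _)

/-- Multiplication on the left decreases the weight by at most a constant factor. -/
theorem exists_weight_le (hq : IsPositiveRegular q) (α : FreeMonoid (Fin n)) :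
    ∃ C : ℝ, 0 < C ∧ ∀ β, weight q β ≤ C * weight q (α * β) := by
  induction α using FreeMonoid.recOn with
  | one => exact ⟨1, one_pos, fun β => by rw [one_mul, one_mul]⟩
  | of_mul j α ih =>
    obtain ⟨C, hC, h⟩ := ih
    have ha : 0 < q.coeff (FreeMonoid.of j) := (hq.nonneg _).lt_of_ne' (hq.linear_ne_zero j)
    -- The constant is the inverse of the product of the linear coefficients of the letters of α.
    refine ⟨C / q.coeff (FreeMonoid.of j), by positivity, fun β => ?_⟩
    rw [div_mul_eq_mul_div, le_div_iff₀ ha, mul_assoc (FreeMonoid.of j)]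
    calc weight q β * q.coeff (FreeMonoid.of j)
        ≤ C * weight q (α * β) * q.coeff (FreeMonoid.of j) :=
          mul_le_mul_of_nonneg_right (h β) ha.le
      _ = C * (q.coeff (FreeMonoid.of j) * weight q (α * β)) := by ring
      _ ≤ _ := mul_le_mul_of_nonneg_left (coeff_mul_weight_le hq _ _) hC.le

open Classical in
/-- The terms of the recursion, indexed by the prefixes of `β` in a finite set of words, add up
to at most the weight of `β`. -/
theorem sum_coeff_mul_weight_le (hq : IsPositiveRegular q) (β : FreeMonoid (Fin n))
    (s : Finset (FreeMonoid (Fin n))) (f : FreeMonoid (Fin n) → ℝ)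
    (hf : ∀ α δ, β = α * δ → f α = q.coeff α * weight q δ)
    (hf' : ∀ α, (¬ ∃ δ, β = α * δ) → f α = 0) :
    ∑ α ∈ s, f α ≤ weight q β := by
  have hf0 : ∀ α, 0 ≤ f α := fun α => by
    by_cases h : ∃ δ, β = α * δ
    · obtain ⟨δ, h⟩ := h
      rw [hf α δ h]
      exact mul_nonneg (hq.nonneg _) (weight_nonneg hq _)
    · rw [hf' α h]
  -- The recursion fails for the empty word; there the only prefix is 1, whose coefficient vanishes.
  by_cases hβ : β = 1
  · refine le_trans (le_of_eq (Finset.sum_eq_zero fun α _ => ?_)) (weight_nonneg hq _)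
    by_cases h : ∃ δ, β = α * δ
    · obtain ⟨δ, h⟩ := h
      have hα : α = 1 := by
        have h1 := congrArg FreeMonoid.length (h.symm.trans hβ)
        rw [FreeMonoid.length_mul, FreeMonoid.length_one] at h1
        exact FreeMonoid.length_eq_zero.1 (by omega)
      rw [hf α δ h, hα, hq.const_eq_zero, zero_mul]
    · exact hf' α h
  have hβ' : β.toList ≠ [] := hβ
  have h := weight_eq_sum_take q hβ'
  change weight q β = _ at h
  rw [h]
  have key : ∀ i, f (FreeMonoid.ofList (β.toList.take (i + 1))) =
      q.coeff (FreeMonoid.ofList (β.toList.take (i + 1))) *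
        weight q (FreeMonoid.ofList (β.toList.drop (i + 1))) := fun i =>
    hf _ _ (List.take_append_drop (i + 1) β.toList).symm
  simp only [← key]
  have hinj : Set.InjOn (fun i => FreeMonoid.ofList (β.toList.take (i + 1)))
      (Finset.range β.toList.length : Set ℕ) := by
    intro i hi j hj hij
    have := congrArg List.length (show β.toList.take (i + 1) = β.toList.take (j + 1) from hij)
    simp only [Finset.coe_range, Set.mem_Iio] at hi hj
    rw [List.length_take, List.length_take] at this
    omega
  rw [← Finset.sum_image (f := f) hinj]
  rw [← Finset.sum_filter_ne_zero]
  refine Finset.sum_le_sum_of_subset_of_nonneg (fun α hα => ?_) fun α _ _ => hf0 α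
  rw [Finset.mem_filter] at hα
  by_cases hex : ∃ δ, β = α * δ
  · obtain ⟨δ, hδ⟩ := hex
    have hα1 : α ≠ 1 := by
      rintro rfl
      exact hα.2 (by rw [hf _ _ hδ, hq.const_eq_zero, zero_mul])
    have hlen : 0 < α.toList.length := List.length_pos_iff.2 hα1
    have hβl : β.toList = α.toList ++ δ.toList := congrArg FreeMonoid.toList hδ
    refine Finset.mem_image.2 ⟨α.toList.length - 1, ?_, ?_⟩
    · rw [Finset.mem_range, hβl, List.length_append]; omega
    · rw [Nat.sub_add_cancel hlen, hβl, List.take_left]; rfl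
  · exact absurd (hf' α hex) hα.2

end Weight

/-! ### Rows and columns of operators -/

section RowColumn

variable {E : Type*} [NormedAddCommGroup E] [InnerProductSpace ℂ E] [CompleteSpace E]

/-- The Cauchy–Schwarz inequality for the product of a row and a column of operators. -/
theorem norm_sum_mul_le {ι : Type*} (s : Finset ι) (R C : ι → (E →L[ℂ] E)) {c d : ℝ}
    (hc : 0 ≤ c) (hd : 0 ≤ d) (hC : ∀ x, ∑ i ∈ s, ‖C i x‖ ^ 2 ≤ c * ‖x‖ ^ 2)
    (hR : ∀ y, ∑ i ∈ s, ‖star (R i) y‖ ^ 2 ≤ d * ‖y‖ ^ 2) :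
    ‖∑ i ∈ s, R i * C i‖ ≤ √c * √d := by
  refine ContinuousLinearMap.opNorm_le_bound _ (by positivity) fun x => ?_
  set z := (∑ i ∈ s, R i * C i) x with hz
  have h1 : ‖z‖ ^ 2 ≤ √c * √d * ‖x‖ * ‖z‖ := by
    calc ‖z‖ ^ 2 = ‖inner ℂ z z‖ := by simp [inner_self_eq_norm_sq_to_K]
      _ = ‖∑ i ∈ s, inner ℂ (star (R i) z) (C i x)‖ := by
          congr 1
          conv_lhs => rw [hz]
          rw [← hz, hz, sum_apply, inner_sum]
          refine Finset.sum_congr rfl fun i _ => ?_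
          rw [ContinuousLinearMap.star_eq_adjoint, ContinuousLinearMap.adjoint_inner_left]
          rfl
      _ ≤ ∑ i ∈ s, ‖star (R i) z‖ * ‖C i x‖ :=
          (norm_sum_le _ _).trans (Finset.sum_le_sum fun i _ => norm_inner_le_norm _ _)
      _ ≤ √(∑ i ∈ s, ‖star (R i) z‖ ^ 2) * √(∑ i ∈ s, ‖C i x‖ ^ 2) :=
          Real.sum_mul_le_sqrt_mul_sqrt _ _ _
      _ ≤ √(d * ‖z‖ ^ 2) * √(c * ‖x‖ ^ 2) := by gcongr; exacts [hR z, hC x]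
      _ = √c * √d * ‖x‖ * ‖z‖ := by
          rw [Real.sqrt_mul hd, Real.sqrt_mul hc, Real.sqrt_sq (norm_nonneg _),
            Real.sqrt_sq (norm_nonneg _)]
          ring
  rcases (norm_nonneg z).eq_or_lt with h0 | h0
  · rw [← h0]; positivity
  · exact le_of_mul_le_mul_right (by rwa [← sq]) h0

theorem re_inner_star_mul_self (T : E →L[ℂ] E) (x : E) :
    RCLike.re (inner ℂ ((star T * T) x) x) = ‖T x‖ ^ 2 := by
  rw [mul_apply_eq_comp, ContinuousLinearMap.star_eq_adjoint,
    ContinuousLinearMap.adjoint_inner_left, inner_self_eq_norm_sq]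

theorem sum_mul_norm_sq_le {ι : Type*} (s : Finset ι) (c : ι → ℝ) (T : ι → (E →L[ℂ] E)) (x : E) :
    ∑ i ∈ s, c i * ‖T i x‖ ^ 2 ≤
      ‖∑ i ∈ s, ((c i : ℝ) : ℂ) • (star (T i) * T i)‖ * ‖x‖ ^ 2 := by
  have h : ∑ i ∈ s, c i * ‖T i x‖ ^ 2 =
      RCLike.re (inner ℂ ((∑ i ∈ s, ((c i : ℝ) : ℂ) • (star (T i) * T i)) x) x) := by
    rw [sum_apply, sum_inner, map_sum]
    refine Finset.sum_congr rfl fun i _ => ?_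
    rw [smul_apply, inner_smul_left, Complex.conj_ofReal]
    exact ((Complex.re_ofReal_mul _ _).trans
      (congrArg (c i * ·) (re_inner_star_mul_self (T i) x))).symm
  rw [h]
  refine (RCLike.re_le_norm _).trans ((norm_inner_le_norm _ _).trans ?_)
  rw [sq, ← mul_assoc]
  gcongr
  exact ContinuousLinearMap.le_opNorm _ _

/-- A bound on the quadratic form of `∑ c_i T_i^* T_i` bounds its norm. -/
theorem norm_sum_star_mul_self_le {ι : Type*} (s : Finset ι) (c : ι → ℝ) (hc : ∀ i, 0 ≤ c i)
    (T : ι → (E →L[ℂ] E)) {M : ℝ} (hM : 0 ≤ M)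
    (h : ∀ x, ∑ i ∈ s, c i * ‖T i x‖ ^ 2 ≤ M * ‖x‖ ^ 2) :
    ‖∑ i ∈ s, ((c i : ℝ) : ℂ) • (star (T i) * T i)‖ ≤ M := by
  have h' : ∀ x, ∑ i ∈ s, ‖(((√(c i) : ℝ) : ℂ) • T i) x‖ ^ 2 ≤ M * ‖x‖ ^ 2 := fun x => by
    refine le_trans (le_of_eq (Finset.sum_congr rfl fun i _ => ?_)) (h x)
    rw [smul_apply, norm_smul, mul_pow, Complex.norm_real, Real.norm_eq_abs,
      sq_abs, Real.sq_sqrt (hc i)]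
  -- The sum is the row of the adjoints of √c_i T_i times the column of the √c_i T_i.
  have := norm_sum_mul_le s (fun i => star (((√(c i) : ℝ) : ℂ) • T i))
    (fun i => ((√(c i) : ℝ) : ℂ) • T i) hM hM h' (by simpa only [star_star] using h')
  rw [Real.mul_self_sqrt hM] at this
  refine le_trans (le_of_eq ?_) this
  congr 1
  refine Finset.sum_congr rfl fun i _ => ?_
  rw [star_smul, smul_mul_smul_comm, ← starRingEnd_apply, Complex.conj_ofReal, ← Complex.ofReal_mul,
    Real.mul_self_sqrt (hc i)]

end RowColumn

/-! ### Operators on the Hilbert tensor product -/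

section OpTensor

variable {K H : Type*} [NormedAddCommGroup K] [InnerProductSpace ℂ K]
  [NormedAddCommGroup H] [InnerProductSpace ℂ H]

/-- Elementary tensors span a dense subspace; the algebraic identities below are all checked on
them. -/
theorem hilbertTensor_ext {S T : HilbertTensor K H →L[ℂ] HilbertTensor K H}
    (h : ∀ x y, S ((x ⊗ₜ[ℂ] y : K ⊗[ℂ] H) : HilbertTensor K H) =
      T ((x ⊗ₜ[ℂ] y : K ⊗[ℂ] H) : HilbertTensor K H)) : S = T := by
  refine ContinuousLinearMap.ext fun z => ?_
  induction z using UniformSpace.Completion.induction_on with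
  | hp => exact isClosed_eq S.continuous T.continuous
  | ih z =>
    induction z using TensorProduct.induction_on with
    | zero => exact (map_zero S).trans (map_zero T).symm
    | tmul x y => exact h x y
    | add a b ha hb => rw [UniformSpace.Completion.coe_add, map_add, map_add, ha, hb]

theorem norm_opTensor_le (A : K →L[ℂ] K) (X : H →L[ℂ] H) : ‖opTensor A X‖ ≤ ‖A‖ * ‖X‖ := by
  refine ContinuousLinearMap.opNorm_le_bound _ (by positivity) fun z => ?_
  induction z using UniformSpace.Completion.induction_on with
  | hp => exact isClosed_le (by fun_prop) (by fun_prop)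
  | ih z =>
    rw [opTensor_coe, UniformSpace.Completion.norm_coe, UniformSpace.Completion.norm_coe]
    exact (ContinuousLinearMap.le_opNorm _ _).trans
      (mul_le_mul_of_nonneg_right (TensorProduct.norm_mapL_le _ _) (norm_nonneg _))

theorem opTensor_mul (A B : K →L[ℂ] K) (X Y : H →L[ℂ] H) :
    opTensor A X * opTensor B Y = opTensor (A * B) (X * Y) :=
  hilbertTensor_ext fun x y => by
    simp only [mul_apply_eq_comp, opTensor_tmul]

theorem opTensor_smul_left (c : ℂ) (A : K →L[ℂ] K) (X : H →L[ℂ] H) :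
    opTensor (c • A) X = c • opTensor A X :=
  hilbertTensor_ext fun x y => by
    simp only [smul_apply, opTensor_tmul, ← TensorProduct.smul_tmul',
      UniformSpace.Completion.coe_smul]

theorem opTensor_smul_right (c : ℂ) (A : K →L[ℂ] K) (X : H →L[ℂ] H) :
    opTensor A (c • X) = c • opTensor A X :=
  hilbertTensor_ext fun x y => by
    simp only [smul_apply, opTensor_tmul, TensorProduct.tmul_smul,
      UniformSpace.Completion.coe_smul]

theorem coe_finset_sum {ι : Type*} (s : Finset ι) (f : ι → K ⊗[ℂ] H) :
    ((∑ i ∈ s, f i : K ⊗[ℂ] H) : HilbertTensor K H) = ∑ i ∈ s, (f i : HilbertTensor K H) :=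
  map_sum (UniformSpace.Completion.toComplL : K ⊗[ℂ] H →L[ℂ] HilbertTensor K H) f s

theorem opTensor_sum_left {ι : Type*} (s : Finset ι) (A : ι → (K →L[ℂ] K)) (X : H →L[ℂ] H) :
    opTensor (∑ i ∈ s, A i) X = ∑ i ∈ s, opTensor (A i) X :=
  hilbertTensor_ext fun x y => by
    simp only [sum_apply, opTensor_tmul, TensorProduct.sum_tmul,
      coe_finset_sum]

theorem opTensor_sum_right {ι : Type*} (s : Finset ι) (A : K →L[ℂ] K) (X : ι → (H →L[ℂ] H)) :
    opTensor A (∑ i ∈ s, X i) = ∑ i ∈ s, opTensor A (X i) :=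
  hilbertTensor_ext fun x y => by
    simp only [sum_apply, opTensor_tmul, TensorProduct.tmul_sum,
      coe_finset_sum]

theorem star_opTensor [CompleteSpace K] [CompleteSpace H] (A : K →L[ℂ] K) (X : H →L[ℂ] H) :
    star (opTensor A X) = opTensor (star A) (star X) := by
  symm
  rw [ContinuousLinearMap.star_eq_adjoint (opTensor A X), ContinuousLinearMap.eq_adjoint_iff]
  intro z w
  induction z, w using UniformSpace.Completion.induction_on₂ with
  | hp => exact isClosed_eq (by fun_prop) (by fun_prop)
  | ih z w =>
    rw [opTensor_coe, opTensor_coe, UniformSpace.Completion.inner_coe,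
      UniformSpace.Completion.inner_coe]
    induction z using TensorProduct.induction_on with
    | zero => simp
    | add a b ha hb => rw [map_add, inner_add_left, inner_add_left, ha, hb]
    | tmul x y =>
      induction w using TensorProduct.induction_on with
      | zero => simp
      | add a b ha hb => rw [map_add, inner_add_right, inner_add_right, ha, hb]
      | tmul x' y' =>
        rw [TensorProduct.mapL_tmul, TensorProduct.mapL_tmul, TensorProduct.inner_tmul,
          TensorProduct.inner_tmul, ContinuousLinearMap.star_eq_adjoint,
          ContinuousLinearMap.star_eq_adjoint, ContinuousLinearMap.adjoint_inner_left,
          ContinuousLinearMap.adjoint_inner_left]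

/-- The row–column estimate for sums of elementary tensors. -/
theorem norm_sum_opTensor_le [CompleteSpace K] [CompleteSpace H] {ι : Type*} (s : Finset ι)
    (b : ι → ℝ) (hb : ∀ i, 0 < b i) (A : ι → (K →L[ℂ] K)) (X : ι → (H →L[ℂ] H)) :
    ‖∑ i ∈ s, opTensor (A i) (X i)‖ ≤
      √‖∑ i ∈ s, (((b i)⁻¹ : ℝ) : ℂ) • (star (A i) * A i)‖ *
        √‖∑ i ∈ s, ((b i : ℝ) : ℂ) • (X i * star (X i))‖ := by
  -- The weight is split so that √b_i goes with X_i in the row and 1/√b_i with A_i in the column.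
  have h1 : ∀ i, opTensor (A i) (X i) =
      opTensor 1 (((√(b i) : ℝ) : ℂ) • X i) * opTensor (((√(b i)⁻¹ : ℝ) : ℂ) • A i) 1 := fun i => by
    rw [opTensor_mul, one_mul, mul_one, opTensor_smul_left, opTensor_smul_right, smul_smul,
      ← Complex.ofReal_mul, Real.sqrt_inv, inv_mul_cancel₀ (Real.sqrt_pos.2 (hb i)).ne',
      Complex.ofReal_one, one_smul]
  simp only [h1]
  refine norm_sum_mul_le s _ _ (norm_nonneg _) (norm_nonneg _) (fun z => ?_) (fun z => ?_)
  · have h2 := sum_mul_norm_sq_le s (fun i => (b i)⁻¹)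
      (fun i => (opTensor (A i) (1 : H →L[ℂ] H))) z
    have h3 : ∑ i ∈ s, (((b i)⁻¹ : ℝ) : ℂ) •
        (star (opTensor (A i) (1 : H →L[ℂ] H)) * opTensor (A i) (1 : H →L[ℂ] H)) =
        opTensor (∑ i ∈ s, (((b i)⁻¹ : ℝ) : ℂ) • (star (A i) * A i)) (1 : H →L[ℂ] H) := by
      rw [opTensor_sum_left]
      refine Finset.sum_congr rfl fun i _ => ?_
      rw [star_opTensor, opTensor_mul, opTensor_smul_left, star_one, one_mul]
    rw [h3] at h2
    refine le_trans (le_of_eq (Finset.sum_congr rfl fun i _ => ?_)) (h2.trans ?_)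
    · rw [opTensor_smul_left, smul_apply, norm_smul, mul_pow,
        Complex.norm_real, Real.norm_eq_abs, sq_abs, Real.sq_sqrt (inv_nonneg.2 (hb i).le)]
    · gcongr
      refine (norm_opTensor_le _ _).trans (mul_le_of_le_one_right (norm_nonneg _) ?_)
      exact ContinuousLinearMap.norm_id_le
  · have h2 := sum_mul_norm_sq_le s b
      (fun i => (opTensor (1 : K →L[ℂ] K) (star (X i)))) z
    have h3 : ∑ i ∈ s, ((b i : ℝ) : ℂ) •
        (star (opTensor (1 : K →L[ℂ] K) (star (X i))) * opTensor (1 : K →L[ℂ] K) (star (X i))) =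
        opTensor (1 : K →L[ℂ] K) (∑ i ∈ s, ((b i : ℝ) : ℂ) • (X i * star (X i))) := by
      rw [opTensor_sum_right]
      refine Finset.sum_congr rfl fun i _ => ?_
      rw [star_opTensor, opTensor_mul, opTensor_smul_right, star_one, one_mul, star_star]
    rw [h3] at h2
    refine le_trans (le_of_eq (Finset.sum_congr rfl fun i _ => ?_)) (h2.trans ?_)
    · rw [opTensor_smul_right, star_smul, smul_apply, norm_smul, mul_pow,
        norm_star, Complex.norm_real, Real.norm_eq_abs, sq_abs, Real.sq_sqrt (hb i).le,
        star_opTensor, star_one]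
    · gcongr
      refine (norm_opTensor_le _ _).trans (mul_le_of_le_one_left (norm_nonneg _) ?_)
      exact ContinuousLinearMap.norm_id_le

end OpTensor

/-! ### Order on B(H) with real scalars cast to ℂ -/

section Positivity

variable {H : Type*} [NormedAddCommGroup H] [InnerProductSpace ℂ H] [CompleteSpace H]

theorem ofReal_smul_nonneg {a : ℝ} (ha : 0 ≤ a) {T : H →L[ℂ] H} (hT : 0 ≤ T) :
    0 ≤ ((a : ℝ) : ℂ) • T := by
  rw [Complex.coe_smul]
  exact smul_nonneg ha hT

theorem ofReal_smul_le_smul {a : ℝ} (ha : 0 ≤ a) {S T : H →L[ℂ] H} (h : S ≤ T) :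
    ((a : ℝ) : ℂ) • S ≤ ((a : ℝ) : ℂ) • T := by
  rw [← sub_nonneg, ← smul_sub]
  exact ofReal_smul_nonneg ha (sub_nonneg.2 h)

theorem ofReal_smul_le_smul_of_le {a b : ℝ} (h : a ≤ b) {T : H →L[ℂ] H} (hT : 0 ≤ T) :
    ((a : ℝ) : ℂ) • T ≤ ((b : ℝ) : ℂ) • T := by
  rw [← sub_nonneg, ← sub_smul, ← Complex.ofReal_sub]
  exact ofReal_smul_nonneg (sub_nonneg.2 h) hT

theorem le_norm_smul_one {T : H →L[ℂ] H} (hT : 0 ≤ T) : T ≤ ((‖T‖ : ℝ) : ℂ) • 1 := by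
  have := (CStarAlgebra.norm_le_iff_le_algebraMap T (norm_nonneg _) hT).1 le_rfl
  rwa [Algebra.algebraMap_eq_smul_one, ← Complex.coe_smul] at this

theorem norm_le_one_of_le_one {T : H →L[ℂ] H} (hT : 0 ≤ T) (h : T ≤ 1) : ‖T‖ ≤ 1 :=
  (CStarAlgebra.norm_le_one_iff_of_nonneg T hT).2 h

theorem mul_mul_star_le {S T : H →L[ℂ] H} (A : H →L[ℂ] H) (h : S ≤ T) :
    A * S * star A ≤ A * T * star A := star_right_conjugate_le_conjugate h A

theorem mul_mul_star_nonneg {T : H →L[ℂ] H} (A : H →L[ℂ] H) (h : 0 ≤ T) :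
    0 ≤ A * T * star A := star_right_conjugate_nonneg h A

end Positivity

/-! ### Evaluation of words and homogeneity -/

section Eval

variable {H : Type*} [NormedAddCommGroup H] [InnerProductSpace ℂ H]

theorem evalWord_one {m : ℕ} (T : Fin m → (H →L[ℂ] H)) : evalWord T 1 = 1 := map_one _

theorem evalWord_mul {m : ℕ} (T : Fin m → (H →L[ℂ] H)) (α β : FreeMonoid (Fin m)) :
    evalWord T (α * β) = evalWord T α * evalWord T β := map_mul _ _ _

theorem evalWord_of {m : ℕ} (T : Fin m → (H →L[ℂ] H)) (j : Fin m) :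
    evalWord T (FreeMonoid.of j) = T j := FreeMonoid.lift_eval_of _ _

theorem evalWord_smul {m : ℕ} (c : ℂ) (T : Fin m → (H →L[ℂ] H)) (α : FreeMonoid (Fin m)) :
    evalWord (c • T) α = c ^ α.length • evalWord T α := by
  induction α using FreeMonoid.recOn with
  | one => rw [evalWord_one, evalWord_one, FreeMonoid.length_one, pow_zero, one_smul]
  | of_mul j α ih =>
    rw [evalWord_mul, evalWord_mul, evalWord_of, evalWord_of, ih, FreeMonoid.length_mul,
      FreeMonoid.length_of, pow_add, pow_one, Pi.smul_apply, smul_mul_smul_comm]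

theorem continuous_evalWord {m : ℕ} (α : FreeMonoid (Fin m)) :
    Continuous fun T : Fin m → (H →L[ℂ] H) => evalWord T α := by
  induction α using FreeMonoid.recOn with
  | one => simpa only [evalWord_one] using continuous_const
  | of_mul j α ih =>
    simp only [evalWord_mul, evalWord_of]
    exact (continuous_apply j).mul ih

theorem evalMultiWord_smul {k : ℕ} {n : Fin k → ℕ} (c : ℂ) (X : OpTuple n H)
    (α : ∀ i, FreeMonoid (Fin (n i))) :
    evalMultiWord (c • X) α = c ^ (∑ i, (α i).length) • evalMultiWord X α := by
  induction k with
  | zero => simp [evalMultiWord]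
  | succ k ih =>
    have := ih (fun i => X i.succ) (fun i => α i.succ)
    rw [evalMultiWord] at this ⊢
    rw [evalMultiWord] at this ⊢
    rw [List.ofFn_succ, List.ofFn_succ, List.prod_cons, List.prod_cons, Fin.sum_univ_succ, pow_add,
      ← smul_mul_smul_comm, ← this, ← evalWord_smul]
    rfl

theorem homogeneousPart_smul {K : Type*} [NormedAddCommGroup K] [InnerProductSpace ℂ K]
    {k : ℕ} {n : Fin k → ℕ} (A : (∀ i, FreeMonoid (Fin (n i))) → (K →L[ℂ] K)) (c : ℂ)
    (X : OpTuple n H) (p : Fin k → ℕ) :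
    homogeneousPart A (c • X) p = c ^ (∑ i, p i) • homogeneousPart A X p := by
  rw [homogeneousPart, homogeneousPart, Finset.smul_sum]
  refine Finset.sum_congr rfl fun α hα => ?_
  rw [evalMultiWord_smul, opTensor_smul_right,
    Finset.sum_congr rfl fun i _ => mem_multiWords.1 hα i]

end Eval

/-! ### The maps Φ and row contractivity of words of fixed length -/

section Phi

variable {H : Type*} [NormedAddCommGroup H] [InnerProductSpace ℂ H] [CompleteSpace H]
  {m : ℕ} {q : MonoidAlgebra ℝ (FreeMonoid (Fin m))}

theorem Phi_apply (q : MonoidAlgebra ℝ (FreeMonoid (Fin m))) (T : Fin m → (H →L[ℂ] H))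
    (Y : H →L[ℂ] H) : Phi q T Y = ∑ α ∈ q.coeff.support,
      ((q.coeff α : ℝ) : ℂ) • (evalWord T α * Y * star (evalWord T α)) := by
  rw [Phi, LinearMap.sum_apply]
  refine Finset.sum_congr rfl fun α _ => ?_
  rw [mul_assoc]
  rfl

theorem Phi_nonneg (hq : IsPositiveRegular q) (T : Fin m → (H →L[ℂ] H)) {Y : H →L[ℂ] H}
    (hY : 0 ≤ Y) : 0 ≤ Phi q T Y := by
  rw [Phi_apply]
  exact Finset.sum_nonneg fun α _ => ofReal_smul_nonneg (hq.nonneg _) (mul_mul_star_nonneg _ hY)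

theorem continuous_Phi_one (q : MonoidAlgebra ℝ (FreeMonoid (Fin m))) :
    Continuous fun T : Fin m → (H →L[ℂ] H) => Phi q T 1 := by
  simp only [Phi_apply]
  refine continuous_finsetSum _ fun α _ =>
    (continuous_const_smul ((q.coeff α : ℝ) : ℂ)).comp ?_
  exact ((continuous_evalWord α).mul continuous_const).mul (continuous_evalWord α).star

/-- Without a constant term every word of q has length at least 1, so its term scales by s^(2|α|) ≤
s². -/
theorem Phi_smul_one_le (hq : IsPositiveRegular q) (T : Fin m → (H →L[ℂ] H)) {s : ℝ}
    (hs0 : 0 ≤ s) (hs1 : s ≤ 1) :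
    Phi q (((s : ℝ) : ℂ) • T) 1 ≤ ((s ^ 2 : ℝ) : ℂ) • Phi q T 1 := by
  rw [Phi_apply, Phi_apply, Finset.smul_sum]
  refine Finset.sum_le_sum fun α hα => ?_
  have hlen : 1 ≤ α.length := by
    rw [Nat.one_le_iff_ne_zero]
    intro h
    rw [FreeMonoid.length_eq_zero.1 h] at hα
    exact Finsupp.mem_support_iff.1 hα hq.const_eq_zero
  have h : evalWord (((s : ℝ) : ℂ) • T) α * 1 * star (evalWord (((s : ℝ) : ℂ) • T) α) =
      ((((s ^ α.length) ^ 2 : ℝ)) : ℂ) • (evalWord T α * 1 * star (evalWord T α)) := by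
    rw [evalWord_smul, star_smul, mul_one, mul_one, smul_mul_smul_comm, ← starRingEnd_apply,
      ← Complex.ofReal_pow, Complex.conj_ofReal, ← Complex.ofReal_mul, ← sq]
  rw [h, smul_comm]
  refine ofReal_smul_le_smul_of_le ?_ (ofReal_smul_nonneg (hq.nonneg _)
    (mul_mul_star_nonneg _ zero_le_one))
  gcongr
  exact (pow_le_pow_of_le_one hs0 hs1 hlen).trans_eq (pow_one s)

/-- A word of length l + l' is uniquely a word of length l followed by one of length l'. -/
theorem sum_words_add {M : Type*} [AddCommMonoid M] (l l' : ℕ)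
    (F : FreeMonoid (Fin m) → FreeMonoid (Fin m) → M) :
    ∑ α ∈ words m (l + l'), F (FreeMonoid.ofList (α.toList.take l))
      (FreeMonoid.ofList (α.toList.drop l)) = ∑ β ∈ words m l, ∑ δ ∈ words m l', F β δ := by
  rw [← Finset.sum_product' (f := F)]
  refine Finset.sum_bij' (fun α _ => (FreeMonoid.ofList (α.toList.take l),
    FreeMonoid.ofList (α.toList.drop l))) (fun x _ => x.1 * x.2) ?_ ?_ ?_ ?_ ?_
  · intro α hα
    have hα' : α.toList.length = l + l' := mem_words.1 hα
    rw [Finset.mem_product, mem_words, mem_words]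
    exact ⟨(List.length_take).trans (by omega), (List.length_drop).trans (by omega)⟩
  · rintro ⟨β, δ⟩ h
    rw [Finset.mem_product, mem_words, mem_words] at h
    rw [mem_words, FreeMonoid.length_mul, h.1, h.2]
  · intro α _
    exact List.take_append_drop l α.toList
  · rintro ⟨β, δ⟩ h
    rw [Finset.mem_product, mem_words, mem_words] at h
    obtain ⟨rfl, -⟩ := h
    exact Prod.ext (List.take_left (l₁ := β.toList) (l₂ := δ.toList))
      (List.drop_left (l₁ := β.toList) (l₂ := δ.toList))
  · intros; rfl

/-- The left side collects those terms of Φ(I) whose word has length between 1 and p; the omitted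
terms are positive. -/
theorem sum_range_words_le (hq : IsPositiveRegular q) (T : Fin m → (H →L[ℂ] H)) (p : ℕ) :
    ∑ i ∈ Finset.range p, ∑ β ∈ words m (i + 1),
      ((q.coeff β : ℝ) : ℂ) • (evalWord T β * 1 * star (evalWord T β)) ≤ Phi q T 1 := by
  classical
  rw [← Finset.sum_biUnion, Phi_apply, ← Finset.sum_filter_ne_zero]
  · refine Finset.sum_le_sum_of_subset_of_nonneg (fun β hβ => ?_) fun β _ _ =>
      ofReal_smul_nonneg (hq.nonneg _) (mul_mul_star_nonneg _ zero_le_one)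
    rw [Finset.mem_filter] at hβ
    refine Finsupp.mem_support_iff.2 fun h => hβ.2 ?_
    rw [h, Complex.ofReal_zero, zero_smul]
  · intro i _ j _ hij
    refine Finset.disjoint_left.2 fun β hi hj => hij ?_
    rw [mem_words] at hi hj
    omega

/-- The weighted row of the words of a given length is a contraction. -/
theorem sum_words_le_one (hq : IsPositiveRegular q) {T : Fin m → (H →L[ℂ] H)}
    (hT : Phi q T 1 ≤ 1) (p : ℕ) : ∑ α ∈ words m p,
      ((weight q α : ℝ) : ℂ) • (evalWord T α * 1 * star (evalWord T α)) ≤ 1 := by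
  induction p using Nat.strong_induction_on with
  | _ p ih =>
    rcases Nat.eq_zero_or_pos p with rfl | hp
    · have : words m 0 = {1} := by
        ext α
        rw [mem_words, Finset.mem_singleton, FreeMonoid.length_eq_zero]
      rw [this, Finset.sum_singleton, weight_one, evalWord_one]
      simp
    -- Grouping by the first factor β turns the sum into terms a_β T_β (∑ b_δ T_δ T_δ^*) T_β^*. The
    -- inner sums run over shorter words, so they are at most I by induction, and what remains is
    -- part of Φ(I).
    · refine le_trans ?_ ((sum_range_words_le hq T p).trans hT)
      obtain ⟨F, hF⟩ : ∃ F : FreeMonoid (Fin m) → FreeMonoid (Fin m) → (H →L[ℂ] H),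
          ∀ β δ, F β δ = ((q.coeff β : ℝ) : ℂ) • (evalWord T β * (((weight q δ : ℝ) : ℂ) •
              (evalWord T δ * 1 * star (evalWord T δ))) * star (evalWord T β)) :=
        ⟨_, fun _ _ => rfl⟩
      have h : ∀ α ∈ words m p,
          ((weight q α : ℝ) : ℂ) • (evalWord T α * 1 * star (evalWord T α)) =
          ∑ i ∈ Finset.range p, F (FreeMonoid.ofList (α.toList.take (i + 1)))
            (FreeMonoid.ofList (α.toList.drop (i + 1))) := by
        intro α hα
        have hlen : α.toList.length = p := mem_words.1 hα
        have hne : α.toList ≠ [] := List.length_pos_iff.1 (by omega)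
        have hw := weight_eq_sum_take q hne
        change weight q α = _ at hw
        rw [hw, hlen, Complex.ofReal_sum, Finset.sum_smul]
        refine Finset.sum_congr rfl fun i _ => ?_
        have hα2 : evalWord T α = evalWord T (FreeMonoid.ofList (α.toList.take (i + 1))) *
            evalWord T (FreeMonoid.ofList (α.toList.drop (i + 1))) := by
          rw [← evalWord_mul]
          exact congrArg _ (List.take_append_drop (i + 1) α.toList).symm
        simp only [hF, hα2, star_mul, mul_smul_comm, smul_mul_assoc, smul_smul,
          Complex.ofReal_mul, mul_one, mul_assoc]
      rw [Finset.sum_congr rfl h, Finset.sum_comm]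
      refine Finset.sum_le_sum fun i hi => ?_
      rw [Finset.mem_range] at hi
      obtain ⟨l', rfl⟩ : ∃ l', p = (i + 1) + l' := ⟨p - (i + 1), by omega⟩
      rw [sum_words_add]
      refine Finset.sum_le_sum fun β _ => ?_
      simp only [hF]
      rw [← Finset.smul_sum, ← Finset.sum_mul, ← Finset.mul_sum]
      exact ofReal_smul_le_smul (hq.nonneg _) (mul_mul_star_le _ (ih l' (by omega)))

end Phi

/-! ### Row contractivity in several components -/

section MultiWords

variable {H : Type*} [NormedAddCommGroup H] [InnerProductSpace ℂ H] [CompleteSpace H]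

theorem sum_multiWords_succ {M : Type*} [AddCommMonoid M] {k : ℕ} {n : Fin (k + 1) → ℕ}
    (p : Fin (k + 1) → ℕ) (F : (∀ i, FreeMonoid (Fin (n i))) → M) :
    ∑ α ∈ multiWords n p, F α = ∑ β ∈ words (n 0) (p 0),
      ∑ δ ∈ multiWords (fun i => n i.succ) (fun i => p i.succ),
        F (Fin.cons (α := fun i => FreeMonoid (Fin (n i))) β δ) := by
  rw [← Finset.sum_product'
    (f := fun β δ => F (Fin.cons (α := fun i => FreeMonoid (Fin (n i))) β δ))]
  refine Finset.sum_bij' (fun α _ => (α 0, fun i => α i.succ))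
    (fun x _ => Fin.cons (α := fun i => FreeMonoid (Fin (n i))) x.1 x.2) ?_ ?_ ?_ ?_ ?_
  · intro α hα
    rw [mem_multiWords] at hα
    rw [Finset.mem_product, mem_words, mem_multiWords]
    exact ⟨hα 0, fun i => hα i.succ⟩
  · rintro ⟨β, δ⟩ h
    rw [Finset.mem_product, mem_words, mem_multiWords] at h
    rw [mem_multiWords]
    exact Fin.cases h.1 h.2
  · intro α _
    exact Fin.cons_self_tail α
  · rintro ⟨β, δ⟩ _
    rfl
  · intro α _
    exact congrArg F (Fin.cons_self_tail α).symm

/-- The first component stands leftmost in X_α, so the sum over the other components sits between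
X_{1,β} and its adjoint and is replaced by I; the one-component estimate then finishes the
induction. -/
theorem sum_multiWords_le_one {k : ℕ} {n : Fin k → ℕ}
    {q : ∀ i, MonoidAlgebra ℝ (FreeMonoid (Fin (n i)))} (hq : ∀ i, IsPositiveRegular (q i))
    {X : OpTuple n H} (hX : ∀ i, Phi (q i) (X i) 1 ≤ 1) (p : Fin k → ℕ) :
    ∑ α ∈ multiWords n p, ((∏ i, weight (q i) (α i) : ℝ) : ℂ) •
      (evalMultiWord X α * star (evalMultiWord X α)) ≤ 1 := by
  induction k with
  | zero =>
    have : multiWords n p = {fun i => i.elim0} := by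
      ext α
      rw [mem_multiWords, Finset.mem_singleton]
      exact ⟨fun _ => funext fun i => i.elim0, fun _ i => i.elim0⟩
    rw [this, Finset.sum_singleton]
    simp [evalMultiWord]
  | succ k ih =>
    rw [sum_multiWords_succ]
    refine le_trans (Finset.sum_le_sum fun β _ => ?_) (sum_words_le_one (hq 0) (hX 0) (p 0))
    have h := ih (fun i => hq i.succ) (fun i => hX i.succ) (fun i => p i.succ)
    refine le_trans (le_of_eq ?_) (ofReal_smul_le_smul (weight_nonneg (hq 0) β)
      (mul_mul_star_le (evalWord (X 0) β) h))
    rw [Finset.mul_sum, Finset.sum_mul, Finset.smul_sum]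
    refine Finset.sum_congr rfl fun δ _ => ?_
    have he : evalMultiWord X (Fin.cons (α := fun i => FreeMonoid (Fin (n i))) β δ) =
        evalWord (X 0) β * evalMultiWord (fun i => X i.succ) δ := by
      rw [evalMultiWord, List.ofFn_succ, List.prod_cons]
      rfl
    rw [he, Fin.prod_univ_succ]
    simp only [Fin.cons_zero, Fin.cons_succ, star_mul, mul_smul_comm, smul_mul_assoc, smul_smul,
      Complex.ofReal_mul, mul_assoc]

/-- The norm of a homogeneous part is at most the square root of the norm of the Gram operator of
its coefficients. -/
theorem norm_homogeneousPart_le {K : Type*} [NormedAddCommGroup K] [InnerProductSpace ℂ K]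
    [CompleteSpace K] {k : ℕ} {n : Fin k → ℕ}
    {q : ∀ i, MonoidAlgebra ℝ (FreeMonoid (Fin (n i)))} (hq : ∀ i, IsPositiveRegular (q i))
    (A : (∀ i, FreeMonoid (Fin (n i))) → (K →L[ℂ] K))
    {X : OpTuple n H} (hX : ∀ i, Phi (q i) (X i) 1 ≤ 1) (p : Fin k → ℕ) :
    ‖homogeneousPart A X p‖ ≤ √‖coeffGram q A p‖ := by
  have hw : ∀ α : ∀ i, FreeMonoid (Fin (n i)), 0 < ∏ i, weight (q i) (α i) :=
    fun α => Finset.prod_pos fun i _ => weight_pos (hq i) _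
  refine (norm_sum_opTensor_le (multiWords n p) (fun α => ∏ i, weight (q i) (α i)) hw A
    (evalMultiWord X)).trans (mul_le_of_le_one_right (Real.sqrt_nonneg _) ?_)
  rw [Real.sqrt_le_one]
  refine norm_le_one_of_le_one (Finset.sum_nonneg fun α _ => ?_) (sum_multiWords_le_one hq hX p)
  exact ofReal_smul_nonneg (hw α).le (mul_star_self_nonneg _)

end MultiWords

/-! ### Defect maps and the geometry of the polydomain -/

section Defect

variable {H : Type*} [NormedAddCommGroup H] [InnerProductSpace ℂ H] [CompleteSpace H]
  {k : ℕ} {n : Fin k → ℕ} {q : ∀ i, MonoidAlgebra ℝ (FreeMonoid (Fin (n i)))}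

omit [CompleteSpace H] in
theorem commute_evalWord {m m' : ℕ} {S : Fin m → (H →L[ℂ] H)} {T : Fin m' → (H →L[ℂ] H)}
    (h : ∀ a b, Commute (S a) (T b)) (α : FreeMonoid (Fin m)) (β : FreeMonoid (Fin m')) :
    Commute (evalWord S α) (evalWord T β) := by
  induction α using FreeMonoid.recOn with
  | one => rw [evalWord_one]; exact Commute.one_left _
  | of_mul j α ih =>
    rw [evalWord_mul, evalWord_of]
    refine Commute.mul_left ?_ ih
    clear ih
    induction β using FreeMonoid.recOn with
    | one => rw [evalWord_one]; exact Commute.one_right _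
    | of_mul i β ih =>
      rw [evalWord_mul, evalWord_of]
      exact Commute.mul_right (h j i) ih

theorem commute_conj {S T : H →L[ℂ] H} (h : Commute S T) : Commute (conj S) (conj T) := by
  refine LinearMap.ext fun Y => ?_
  change S * (T * (Y * star T) * star S) = T * (S * (Y * star S) * star T)
  simp only [mul_assoc]
  rw [h.star_star.eq, ← mul_assoc, h.eq, mul_assoc]

theorem commute_Phi {X : OpTuple n H} (hX : CrossCommute X) {s t : Fin k} (hst : s ≠ t) :
    Commute (Phi (q s) (X s)) (Phi (q t) (X t)) :=
  Commute.sum_left _ _ _ fun α _ => Commute.sum_right _ _ _ fun β _ =>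
    ((commute_conj (commute_evalWord (hX s t hst) α β)).smul_left _).smul_right _

/-- Cross-commutation makes the Φ's commute, so the j-th factor can be pulled to the front of the
ordered product. -/
theorem defect_update (X : OpTuple n H) (hX : CrossCommute X) (p : Fin k → ℕ) (j : Fin k) :
    defect q X (Function.update p j 1) =
      (1 - Phi (q j) (X j)) * defect q X (Function.update p j 0) := by
  have key : ∀ L : List (Fin k), L.Nodup →
      (j ∉ L → (L.map fun i => (1 - Phi (q i) (X i)) ^ Function.update p j 1 i).prod =
        (L.map fun i => (1 - Phi (q i) (X i)) ^ Function.update p j 0 i).prod) ∧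
      (j ∈ L → (L.map fun i => (1 - Phi (q i) (X i)) ^ Function.update p j 1 i).prod =
        (1 - Phi (q j) (X j)) *
          (L.map fun i => (1 - Phi (q i) (X i)) ^ Function.update p j 0 i).prod) := by
    intro L hL
    induction L with
    | nil => simp
    | cons i L ih =>
      rw [List.nodup_cons] at hL
      obtain ⟨ih1, ih2⟩ := ih hL.2
      simp only [List.map_cons, List.prod_cons, List.mem_cons, not_or]
      constructor
      · rintro ⟨hij, hj⟩
        rw [ih1 hj, Function.update_of_ne (Ne.symm hij), Function.update_of_ne (Ne.symm hij)]
      · intro hj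
        by_cases hij : j = i
        · subst hij
          rw [ih1 hL.1, Function.update_self, Function.update_self, pow_one, pow_zero, one_mul]
        · have hj' : j ∈ L := hj.resolve_left hij
          rw [ih2 hj', Function.update_of_ne (Ne.symm hij), Function.update_of_ne (Ne.symm hij),
            ← mul_assoc, ← mul_assoc]
          congr 1
          exact (((Commute.one_left _).sub_left ((Commute.one_right _).sub_right
            (commute_Phi hX (Ne.symm hij)))).pow_left _)
  rw [defect, defect, List.ofFn_eq_map, List.ofFn_eq_map]
  exact (key _ (List.nodup_finRange k)).2 (List.mem_finRange j)

theorem defect_zero (X : OpTuple n H) : defect q X 0 = 1 := by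
  simp [defect, List.ofFn_eq_map]

theorem defect_single (X : OpTuple n H) (hX : CrossCommute X) (j : Fin k) :
    defect q X (Pi.single j 1) 1 = 1 - Phi (q j) (X j) 1 := by
  rw [Pi.single, defect_update X hX, Function.update_eq_self_iff.2 (by simp), defect_zero, mul_one]
  rfl

/-- Switching on the j-th exponent subtracts Φ_j of a positive operator. -/
theorem defect_update_le (hq : ∀ i, IsPositiveRegular (q i)) {X : OpTuple n H}
    (hX : X ∈ closedPolydomain q H) {p : Fin k → ℕ} (hp : ∀ i, p i ≤ 1) (j : Fin k) :
    defect q X (Function.update p j 1) 1 ≤ defect q X (Function.update p j 0) 1 := by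
  rw [defect_update X hX.1]
  change defect q X (Function.update p j 0) 1 -
    Phi (q j) (X j) (defect q X (Function.update p j 0) 1) ≤ _
  refine sub_le_self _ (Phi_nonneg (hq j) _ ?_)
  refine (ContinuousLinearMap.nonneg_iff_isPositive _).2 (hX.2 _ fun i => ?_)
  by_cases h : i = j
  · subst h; simp
  · rw [Function.update_of_ne h]; exact hp i

theorem defect_one_le (hq : ∀ i, IsPositiveRegular (q i)) {X : OpTuple n H}
    (hX : X ∈ closedPolydomain q H) (j : Fin k) :
    defect q X (fun _ => 1) 1 ≤ 1 - Phi (q j) (X j) 1 := by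
  classical
  -- The exponents other than the j-th are switched off one at a time, each time increasing the
  -- defect.
  have key : ∀ S : Finset (Fin k), j ∉ S →
      defect q X (fun _ => 1) 1 ≤ defect q X (fun i => if i ∈ S then 0 else 1) 1 := by
    intro S
    induction S using Finset.induction_on with
    | empty => intro _; simp
    | insert a S ha ih =>
      intro hj
      refine (ih fun h => hj (Finset.mem_insert_of_mem h)).trans ?_
      have h := defect_update_le hq hX (p := fun i => if i ∈ S then 0 else 1)
        (fun i => by split_ifs <;> omega) a
      have h1 : Function.update (fun i => if i ∈ S then 0 else 1) a 1 =
          fun i => if i ∈ S then 0 else 1 := by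
        rw [Function.update_eq_self_iff, if_neg ha]
      have h0 : Function.update (fun i => if i ∈ S then 0 else 1) a 0 =
          fun i => if i ∈ insert a S then 0 else 1 := by
        funext i
        by_cases hi : i = a
        · subst hi; simp
        · rw [Function.update_of_ne hi]; simp [hi]
      rwa [h1, h0] at h
  refine (key (Finset.univ.erase j) (Finset.notMem_erase _ _)).trans (le_of_eq ?_)
  rw [← defect_single X hX.1 j]
  congr 2
  funext i
  by_cases hi : i = j
  · subst hi; simp
  · simp [hi]

theorem Phi_one_le_of_mem_closed {X : OpTuple n H}
    (hX : X ∈ closedPolydomain q H) (j : Fin k) : Phi (q j) (X j) 1 ≤ 1 := by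
  rw [← sub_nonneg, ← defect_single X hX.1 j, ContinuousLinearMap.nonneg_iff_isPositive]
  refine hX.2 _ fun i => ?_
  by_cases hi : i = j
  · subst hi; simp
  · simp [hi]

/-- Row contractivity is a norm closed condition, so it survives the closure; part (i) needs nothing
else about the closure. -/
theorem Phi_one_le_of_mem_closure {X : OpTuple n H}
    (hX : X ∈ closure (openPolydomain q H)) (j : Fin k) : Phi (q j) (X j) 1 ≤ 1 := by
  have hc : IsClosed {X : OpTuple n H | Phi (q j) (X j) 1 ≤ 1} :=
    isClosed_le ((continuous_Phi_one (q j)).comp (continuous_apply j)) continuous_const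
  exact closure_minimal (fun X hX => Phi_one_le_of_mem_closed hX.1 j) hc hX

/-- An invertible positive defect is at least some δ > 0, and it is at most I - Φ_j(I); hence Φ_j(I)
≤ 1 - δ. -/
theorem norm_Phi_one_lt_of_mem_open (hq : ∀ i, IsPositiveRegular (q i)) {X : OpTuple n H}
    (hX : X ∈ openPolydomain q H) (j : Fin k) : ‖Phi (q j) (X j) 1‖ < 1 := by
  rcases subsingleton_or_nontrivial (H →L[ℂ] H) with hs | hs
  · rw [Subsingleton.elim (Phi (q j) (X j) 1) 0, norm_zero]
    exact one_pos
  obtain ⟨hX, hu⟩ := hX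
  have hpos : 0 ≤ defect q X (fun _ => 1) 1 :=
    (ContinuousLinearMap.nonneg_iff_isPositive _).2 (hX.2 _ fun _ => le_rfl)
  have hsp := IsStrictlyPositive.iff_of_unital.2 ⟨hpos, hu⟩
  obtain ⟨δ, hδ, h⟩ := (CFC.exists_pos_algebraMap_le_iff hsp.isSelfAdjoint).2
    fun x hx => hsp.spectrum_pos hx
  have h0 := Phi_nonneg (hq j) (X j) zero_le_one
  have h1 := le_sub_comm.1 (h.trans (defect_one_le hq hX j))
  -- The maximum with 0 is there because the norm criterion asks for a nonnegative bound.
  have h2 : Phi (q j) (X j) 1 ≤ algebraMap ℝ (H →L[ℂ] H) (max (1 - δ) 0) := by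
    refine h1.trans ?_
    rw [← map_one (algebraMap ℝ (H →L[ℂ] H)), ← map_sub]
    exact algebraMap_mono _ (le_max_left _ _)
  refine ((CStarAlgebra.norm_le_iff_le_algebraMap _ (le_max_right _ _) h0).2 h2).trans_lt ?_
  exact max_lt (by linarith) one_pos

theorem Phi_one_le_one_of_norm_le {m : ℕ} {q : MonoidAlgebra ℝ (FreeMonoid (Fin m))}
    (hq : IsPositiveRegular q) (T : Fin m → (H →L[ℂ] H)) (h : ‖Phi q T 1‖ ≤ 1) : Phi q T 1 ≤ 1 :=
  (CStarAlgebra.norm_le_one_iff_of_nonneg _ (Phi_nonneg hq T zero_le_one)).1 h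

/-- A point of the polydomain of radius `γ` is a multiple, of ratio less than `γ`, of a tuple with
row contractive components. -/
theorem exists_smul_of_mem_polydomainOfRadius (hq : ∀ i, IsPositiveRegular (q i)) {γ : ℝ≥0∞}
    (hγ : γ ≠ 0) {X : OpTuple n H} (hX : X ∈ polydomainOfRadius q H γ) :
    ∃ (r : ℝ≥0) (Y : OpTuple n H), (r : ℝ≥0∞) < γ ∧ (∀ j, Phi (q j) (Y j) 1 ≤ 1) ∧
      X = ((r : ℝ) : ℂ) • Y := by
  rw [polydomainOfRadius] at hX
  split_ifs at hX with htop
  -- For γ = ∞ any finite ratio is allowed: dividing by 1 + M brings Φ_j(I) below M/(1 + M)² ≤ 1.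
  · set M : ℝ := ∑ j, ‖Phi (q j) (X j) 1‖ with hM
    have hM0 : 0 ≤ M := Finset.sum_nonneg fun _ _ => norm_nonneg _
    have h1 : 0 < 1 + M := by linarith
    refine ⟨⟨1 + M, h1.le⟩, (((1 + M)⁻¹ : ℝ) : ℂ) • X, ?_, fun j => ?_, ?_⟩
    · rw [htop]; exact ENNReal.coe_lt_top
    · refine (Phi_smul_one_le (hq j) (X j) (inv_nonneg.2 h1.le)
        (inv_le_one_of_one_le₀ (by linarith))).trans ?_
      refine (ofReal_smul_le_smul (by positivity)
        (le_norm_smul_one (Phi_nonneg (hq j) _ zero_le_one))).trans ?_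
      rw [smul_smul, ← Complex.ofReal_mul]
      refine (ofReal_smul_le_smul_of_le (b := 1) ?_ zero_le_one).trans (by simp)
      have h2 : ‖Phi (q j) (X j) 1‖ ≤ M :=
        Finset.single_le_sum (f := fun j => ‖Phi (q j) (X j) 1‖) (fun _ _ => norm_nonneg _)
          (Finset.mem_univ j)
      rw [inv_pow, inv_mul_le_iff₀ (by positivity), mul_one]
      nlinarith
    · change X = (((1 + M : ℝ)) : ℂ) • ((((1 + M)⁻¹ : ℝ) : ℂ) • X)
      rw [smul_smul, ← Complex.ofReal_mul, mul_inv_cancel₀ h1.ne', Complex.ofReal_one, one_smul]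
  · obtain ⟨Y, hY, rfl⟩ := hX
    -- The strict inequalities persist for cY with some c > 1, and γY = (γ/c)(cY) has ratio γ/c < γ.
    have hev : ∀ᶠ c : ℝ in nhds 1, ∀ j, ‖Phi (q j) (((c : ℝ) : ℂ) • Y j) 1‖ < 1 := by
      rw [Filter.eventually_all]
      intro j
      have hcont : Continuous fun c : ℝ => ‖Phi (q j) (((c : ℝ) : ℂ) • Y j) 1‖ :=
        ((continuous_Phi_one (q j)).comp
          (Complex.continuous_ofReal.smul continuous_const)).norm
      refine hcont.continuousAt.eventually_lt continuousAt_const ?_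
      rw [Complex.ofReal_one, one_smul]
      exact norm_Phi_one_lt_of_mem_open hq hY j
    obtain ⟨c, hc, hc1⟩ := ((hev.filter_mono nhdsWithin_le_nhds).and
      (self_mem_nhdsWithin (a := (1 : ℝ)) (s := Set.Ioi 1))).exists
    replace hc1 : 1 < c := hc1
    have hc0 : 0 < c := one_pos.trans hc1
    lift c to ℝ≥0 using hc0.le
    refine ⟨γ.toNNReal / c, ((c : ℝ) : ℂ) • Y, ?_, fun j => ?_, ?_⟩
    · rw [← ENNReal.coe_toNNReal htop] at hγ
      conv_rhs => rw [← ENNReal.coe_toNNReal htop]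
      rw [ENNReal.coe_ne_zero] at hγ
      rw [ENNReal.coe_lt_coe, ← NNReal.coe_lt_coe, NNReal.coe_div]
      exact div_lt_self (NNReal.coe_pos.2 (pos_iff_ne_zero.2 hγ)) hc1
    · exact Phi_one_le_one_of_norm_le (hq j) (((c : ℝ) : ℂ) • Y j) (hc j).le
    · rw [smul_smul, ← Complex.ofReal_mul, NNReal.coe_div, div_mul_cancel₀ _ hc0.ne']
      rfl

end Defect

/-! ### The root test over multi-indices -/

section RootTest

theorem summable_pow_sum {t : ℝ} (ht0 : 0 ≤ t) (ht1 : t < 1) (k : ℕ) :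
    Summable fun p : Fin k → ℕ => t ^ ∑ i, p i := by
  induction k with
  | zero => exact (hasSum_fintype _).summable
  | succ k ih =>
    rw [← (Fin.consEquiv fun _ : Fin (k + 1) => ℕ).summable_iff]
    refine ((summable_geometric_of_lt_one ht0 ht1).mul_of_nonneg ih
      (fun _ => by positivity) (fun _ => by positivity)).congr fun x => ?_
    simp [Fin.consEquiv, Fin.sum_univ_succ, pow_add]

/-- For r < ρ < γ all but finitely many √(g p) are at most ρ^(-|p|), so the series is dominated by
that of (r/ρ)^|p|, a product of k geometric series. -/
theorem summable_pow_mul_sqrt {k : ℕ} (g : (Fin k → ℕ) → ℝ) (hg : ∀ p, 0 ≤ g p) {γ : ℝ≥0∞}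
    (hγ : γ⁻¹ = Filter.limsup (fun p : Fin k → ℕ => ENNReal.ofReal
        (g p ^ (1 / (2 * ((∑ i, p i : ℕ) : ℝ))))) Filter.cofinite)
    {r : ℝ≥0} (hr : (r : ℝ≥0∞) < γ) :
    Summable fun p : Fin k → ℕ => (r : ℝ) ^ (∑ i, p i) * √(g p) := by
  obtain ⟨ρ, hrρ, hργ⟩ := ENNReal.lt_iff_exists_nnreal_btwn.1 hr
  rw [ENNReal.coe_lt_coe] at hrρ
  have hρ : 0 < ρ := pos_of_gt hrρ
  have hlim : Filter.limsup (fun p : Fin k → ℕ => ENNReal.ofReal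
      (g p ^ (1 / (2 * ((∑ i, p i : ℕ) : ℝ))))) Filter.cofinite < (ρ : ℝ≥0∞)⁻¹ := by
    rw [← hγ]; exact ENNReal.inv_lt_inv.2 hργ
  have ht1 : (r / ρ : ℝ) < 1 := (div_lt_one (by exact_mod_cast hρ)).2 (by exact_mod_cast hrρ)
  refine Summable.of_norm_bounded_eventually (summable_pow_sum (t := (r / ρ : ℝ))
    (by positivity) ht1 k) ?_
  -- The index p = 0 is discarded: its exponent 1/(2·0) is 0 by convention and carries no
  -- information.
  filter_upwards [Filter.eventually_lt_of_limsup_lt hlim,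
    (Set.finite_singleton (0 : Fin k → ℕ)).compl_mem_cofinite] with p hp hp0
  have hN : ∑ i, p i ≠ 0 := fun h => hp0 (funext fun i =>
    Finset.sum_eq_zero_iff.1 h i (Finset.mem_univ i))
  set N := ∑ i, p i with hNdef
  have hN' : (N : ℝ) ≠ 0 := Nat.cast_ne_zero.2 hN
  have h1 : g p ^ (1 / (2 * (N : ℝ))) ≤ (ρ : ℝ)⁻¹ := by
    rw [← ENNReal.coe_inv hρ.ne', ENNReal.ofReal, ENNReal.coe_lt_coe] at hp
    exact (Real.le_coe_toNNReal _).trans (by exact_mod_cast hp.le)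
  have h2 : √(g p) = (g p ^ (1 / (2 * (N : ℝ)))) ^ N := by
    rw [← Real.rpow_natCast, ← Real.rpow_mul (hg p), Real.sqrt_eq_rpow]
    congr 1
    field_simp
  rw [Real.norm_of_nonneg (by positivity), h2, div_eq_mul_inv (r : ℝ), mul_pow]
  have h3 : 0 ≤ g p ^ (1 / (2 * (N : ℝ))) := Real.rpow_nonneg (hg p) _
  gcongr

end RootTest

/-! ### Absolute and uniform convergence -/

section Convergence

theorem opNorm_smul {E : Type*} [NormedAddCommGroup E] [NormedSpace ℂ E] (c : ℂ)
    (T : E →L[ℂ] E) : ‖c • T‖ = ‖c‖ * ‖T‖ := norm_smul c T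

theorem opNorm_nonneg {E : Type*} [NormedAddCommGroup E] [NormedSpace ℂ E]
    (T : E →L[ℂ] E) : 0 ≤ ‖T‖ := norm_nonneg T

variable {H : Type*} [NormedAddCommGroup H] [InnerProductSpace ℂ H] [CompleteSpace H]
  {K : Type*} [NormedAddCommGroup K] [InnerProductSpace ℂ K] [CompleteSpace K]
  {k : ℕ} {n : Fin k → ℕ} {q : ∀ i, MonoidAlgebra ℝ (FreeMonoid (Fin (n i)))}

theorem norm_homogeneousPart_smul_le (hq : ∀ i, IsPositiveRegular (q i))
    (A : (∀ i, FreeMonoid (Fin (n i))) → (K →L[ℂ] K))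
    {X : OpTuple n H} (hX : ∀ i, Phi (q i) (X i) 1 ≤ 1) (r : ℝ≥0) (p : Fin k → ℕ) :
    ‖homogeneousPart A (((r : ℝ) : ℂ) • X) p‖ ≤ (r : ℝ) ^ (∑ i, p i) * √‖coeffGram q A p‖ := by
  rw [homogeneousPart_smul, opNorm_smul, norm_pow, Complex.norm_real, Real.norm_of_nonneg (NNReal.coe_nonneg r)]
  exact mul_le_mul_of_nonneg_left (norm_homogeneousPart_le hq A hX p) (by positivity)

theorem summable_homogeneousPart (hq : ∀ i, IsPositiveRegular (q i))
    (A : (∀ i, FreeMonoid (Fin (n i))) → (K →L[ℂ] K)) {γ : ℝ≥0∞}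
    (hγ : γ⁻¹ = Filter.limsup
      (fun p : Fin k → ℕ => ENNReal.ofReal
        (‖coeffGram q A p‖ ^ (1 / (2 * ((∑ i, p i : ℕ) : ℝ))))) Filter.cofinite)
    {X : OpTuple n H} (hX : X ∈ polydomainOfRadius q H γ) :
    Summable fun p : Fin k → ℕ => ‖homogeneousPart A X p‖ := by
  -- No ratio is below γ = 0, but then X = 0 and only the term p = 0 survives.
  by_cases h0 : γ = 0
  · have hX0 : X = (0 : ℂ) • X := by
      rw [polydomainOfRadius, if_neg (by simp [h0])] at hX
      obtain ⟨Y, -, rfl⟩ := hX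
      simp [h0]
    refine summable_of_hasFiniteSupport ((Set.finite_singleton (0 : Fin k → ℕ)).subset
      fun p hp => ?_)
    by_contra hp0
    refine hp ?_
    have hN : ∑ i, p i ≠ 0 := fun h => hp0 (funext fun i =>
      Finset.sum_eq_zero_iff.1 h i (Finset.mem_univ i))
    dsimp only
    rw [hX0, homogeneousPart_smul, zero_pow hN, zero_smul]
    exact ContinuousLinearMap.opNorm_zero
  · obtain ⟨r, Y, hr, hY, rfl⟩ := exists_smul_of_mem_polydomainOfRadius hq h0 hX
    exact (summable_pow_mul_sqrt _ (fun _ => norm_nonneg _) hγ hr).of_nonneg_of_le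
      (fun _ => opNorm_nonneg _) (norm_homogeneousPart_smul_le hq A hY r)

/-- Weierstrass M-test: the majorant r^|p| √‖G_p‖ does not depend on the point. -/
theorem summableUniformlyOn_homogeneousPart (hq : ∀ i, IsPositiveRegular (q i))
    (A : (∀ i, FreeMonoid (Fin (n i))) → (K →L[ℂ] K)) {γ : ℝ≥0∞}
    (hγ : γ⁻¹ = Filter.limsup
      (fun p : Fin k → ℕ => ENNReal.ofReal
        (‖coeffGram q A p‖ ^ (1 / (2 * ((∑ i, p i : ℕ) : ℝ))))) Filter.cofinite)
    {r : ℝ≥0} (hr : (r : ℝ≥0∞) < γ) :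
    SummableUniformlyOn
      (fun (p : Fin k → ℕ) (X : OpTuple n H) => ‖homogeneousPart A X p‖)
      (((r : ℝ) : ℂ) • closure (openPolydomain q H)) := by
  refine HasSumUniformlyOn.summableUniformlyOn (hasSumUniformlyOn_iff_tendstoUniformlyOn.2
    (tendstoUniformlyOn_tsum (summable_pow_mul_sqrt _ (fun _ => norm_nonneg _) hγ hr) ?_))
  rintro p _ ⟨X, hX, rfl⟩
  rw [Real.norm_of_nonneg (opNorm_nonneg _)]
  exact norm_homogeneousPart_smul_le hq A (Phi_one_le_of_mem_closure hX) r p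

end Convergence

theorem isUnit_of_smul_one_le {H : Type*} [NormedAddCommGroup H] [InnerProductSpace ℂ H]
    [CompleteSpace H] {T : H →L[ℂ] H} {δ : ℝ} (hδ : 0 < δ) (h : (δ : ℂ) • 1 ≤ T) : IsUnit T := by
  refine CStarAlgebra.isUnit_of_le (algebraMap ℝ (H →L[ℂ] H) δ) ?_
    (isStrictlyPositive_algebraMap hδ)
  rwa [Algebra.algebraMap_eq_smul_one, ← Complex.coe_smul]

/-! ### Weighted composition and diagonal operators on ℓ² -/

section SquareSummable

variable {S : Type v}

/-- The Hilbert space of the square summable families of complex numbers. -/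
abbrev SqSum (S : Type v) : Type v := lp (fun _ : S => ℂ) 2

theorem sum_weightedComp_le {σ : S → S} (hσ : Function.Injective σ) {c : S → ℝ} {C : ℝ}
    (hC0 : 0 ≤ C) (hC : ∀ s, |c s| ≤ C) (f : SqSum S) (F : Finset S) :
    ∑ s ∈ F, ‖(c s : ℂ) * f (σ s)‖ ^ (2 : ℝ≥0∞).toReal ≤ (C * ‖f‖) ^ (2 : ℝ≥0∞).toReal := by
  have h := lp.sum_rpow_le_norm_rpow (p := 2) (by norm_num) f (F.map ⟨σ, hσ⟩)
  rw [Finset.sum_map] at h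
  rw [Real.mul_rpow hC0 (norm_nonneg _)]
  refine le_trans ?_ (mul_le_mul_of_nonneg_left h (Real.rpow_nonneg hC0 _))
  rw [Finset.mul_sum]
  refine Finset.sum_le_sum fun s _ => ?_
  rw [norm_mul, Real.mul_rpow (norm_nonneg _) (norm_nonneg _), Complex.norm_real, Real.norm_eq_abs]
  exact mul_le_mul_of_nonneg_right (Real.rpow_le_rpow (abs_nonneg _) (hC s) (by norm_num))
    (Real.rpow_nonneg (norm_nonneg _) _)

/-- The weighted composition operator `(B f)(s) = c(s) f(σ(s))`, where `σ` is injective and `c` is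
bounded. -/
noncomputable def weightedComp {σ : S → S} (hσ : Function.Injective σ) {c : S → ℝ}
    (hc : ∃ C, 0 ≤ C ∧ ∀ s, |c s| ≤ C) : SqSum S →L[ℂ] SqSum S :=
  LinearMap.mkContinuous
    { toFun := fun f => ⟨fun s => (c s : ℂ) * f (σ s),
        memℓp_gen' (sum_weightedComp_le hσ hc.choose_spec.1 hc.choose_spec.2 f)⟩
      map_add' := fun f g => lp.ext (funext fun s => mul_add (c s : ℂ) (f (σ s)) (g (σ s)))
      map_smul' := fun a f => lp.ext (funext fun s => mul_left_comm (c s : ℂ) a (f (σ s))) }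
    hc.choose fun f => lp.norm_le_of_forall_sum_le (by norm_num)
      (mul_nonneg hc.choose_spec.1 (norm_nonneg f))
      (sum_weightedComp_le hσ hc.choose_spec.1 hc.choose_spec.2 f)

variable {σ : S → S} (hσ : Function.Injective σ) {c : S → ℝ} (hc : ∃ C, 0 ≤ C ∧ ∀ s, |c s| ≤ C)

theorem weightedComp_apply (f : SqSum S) (s : S) :
    weightedComp hσ hc f s = (c s : ℂ) * f (σ s) := rfl

open Classical in
-- A coordinate is a pairing with a basis vector, and the operator sends e_{σ(s)} to c(s) e_s. On
-- basis vectors off the range of σ it vanishes, which gives the companion lemma.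
theorem adjoint_weightedComp_apply (f : SqSum S) (s : S) :
    (star (weightedComp hσ hc)) f (σ s) = (c s : ℂ) * f s := by
  have h1 : ∀ (g : SqSum S) (t : S), g t = inner ℂ (lp.single 2 t (1 : ℂ) : SqSum S) g :=
    fun g t => by rw [lp.inner_single_left]; simp
  have h2 : weightedComp hσ hc (lp.single 2 (σ s) (1 : ℂ) : SqSum S) =
      (c s : ℂ) • (lp.single 2 s (1 : ℂ) : SqSum S) := by
    refine lp.ext (funext fun t => ?_)
    rw [weightedComp_apply, lp.coeFn_smul, Pi.smul_apply, lp.single_apply, lp.single_apply]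
    by_cases hts : t = s
    · subst hts; simp
    · rw [Pi.single_eq_of_ne (hσ.ne hts), Pi.single_eq_of_ne hts, mul_zero, smul_zero]
  rw [h1, ContinuousLinearMap.star_eq_adjoint, ContinuousLinearMap.adjoint_inner_right, h2,
    inner_smul_left, ← h1, Complex.conj_ofReal]

open Classical in
theorem adjoint_weightedComp_apply_of_notMem (f : SqSum S) (t : S) (ht : t ∉ Set.range σ) :
    (star (weightedComp hσ hc)) f t = 0 := by
  have h1 : ∀ (g : SqSum S) (t : S), g t = inner ℂ (lp.single 2 t (1 : ℂ) : SqSum S) g :=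
    fun g t => by rw [lp.inner_single_left]; simp
  have h2 : weightedComp hσ hc (lp.single 2 t (1 : ℂ) : SqSum S) = 0 := by
    refine lp.ext (funext fun s => ?_)
    rw [weightedComp_apply, lp.single_apply, Pi.single_eq_of_ne fun h => ht ⟨s, h⟩, mul_zero]
    rfl
  rw [h1, ContinuousLinearMap.star_eq_adjoint, ContinuousLinearMap.adjoint_inner_right, h2,
    inner_zero_left]

/-- The operator `T` is the multiplication by the function `d`. -/
def IsDiag (T : SqSum S →L[ℂ] SqSum S) (d : S → ℝ) : Prop :=
  ∀ f s, T f s = (d s : ℂ) * f s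

theorem isDiag_one : IsDiag (1 : SqSum S →L[ℂ] SqSum S) fun _ => 1 := fun f s => by simp

theorem IsDiag.sub {T T' : SqSum S →L[ℂ] SqSum S} {d d' : S → ℝ} (h : IsDiag T d)
    (h' : IsDiag T' d') : IsDiag (T - T') fun s => d s - d' s := fun f s => by
  rw [sub_apply, lp.coeFn_sub, Pi.sub_apply, h, h', Complex.ofReal_sub, sub_mul]

theorem IsDiag.smul {T : SqSum S →L[ℂ] SqSum S} {d : S → ℝ} (h : IsDiag T d) (a : ℝ) :
    IsDiag ((a : ℂ) • T) fun s => a * d s := fun f s => by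
  rw [smul_apply, lp.coeFn_smul, Pi.smul_apply, h, Complex.ofReal_mul,
    mul_assoc, smul_eq_mul]

theorem IsDiag.sum {ι : Type*} (F : Finset ι) {T : ι → (SqSum S →L[ℂ] SqSum S)}
    {d : ι → S → ℝ} (h : ∀ i ∈ F, IsDiag (T i) (d i)) :
    IsDiag (∑ i ∈ F, T i) fun s => ∑ i ∈ F, d i s := fun f s => by
  rw [sum_apply, lp.coeFn_sum, Finset.sum_apply, Complex.ofReal_sum, Finset.sum_mul]
  exact Finset.sum_congr rfl fun i hi => h i hi f s

/-- Conjugating a multiplication operator by the adjoint of a weighted composition operator. -/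
theorem IsDiag.conj {T : SqSum S →L[ℂ] SqSum S} {d d' : S → ℝ} (h : IsDiag T d)
    (hd : ∀ s, d' (σ s) = c s ^ 2 * d s) (hd' : ∀ t, t ∉ Set.range σ → d' t = 0) :
    IsDiag (star (weightedComp hσ hc) * T * weightedComp hσ hc) d' := fun f t => by
  rw [mul_apply_eq_comp, mul_apply_eq_comp]
  by_cases ht : t ∈ Set.range σ
  · obtain ⟨s, rfl⟩ := ht
    rw [adjoint_weightedComp_apply, h, weightedComp_apply, hd]
    push_cast
    ring
  · rw [adjoint_weightedComp_apply_of_notMem _ _ _ _ ht, hd' t ht, Complex.ofReal_zero, zero_mul]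

theorem IsDiag.isPositive {T : SqSum S →L[ℂ] SqSum S} {d : S → ℝ} (h : IsDiag T d)
    (hd : ∀ s, 0 ≤ d s) : T.IsPositive := by
  rw [ContinuousLinearMap.isPositive_iff_complex]
  intro f
  have h1 : inner ℂ (T f) f = ((∑' s, d s * ‖f s‖ ^ 2 : ℝ) : ℂ) := by
    rw [lp.inner_eq_tsum, Complex.ofReal_tsum]
    refine tsum_congr fun s => ?_
    rw [h, ← smul_eq_mul, inner_smul_left, Complex.conj_ofReal, inner_self_eq_norm_sq_to_K]
    push_cast
    rfl
  rw [h1]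
  exact ⟨by simp, by simpa using tsum_nonneg fun s => mul_nonneg (hd s) (sq_nonneg _)⟩

theorem IsDiag.isUnit {T : SqSum S →L[ℂ] SqSum S} {d : S → ℝ} (h : IsDiag T d) {δ : ℝ}
    (hδ : 0 < δ) (hd : ∀ s, δ ≤ d s) : IsUnit T := by
  refine isUnit_of_smul_one_le hδ ?_
  rw [ContinuousLinearMap.le_def]
  refine (h.sub (isDiag_one.smul δ)).isPositive fun s => ?_
  rw [mul_one]
  exact sub_nonneg.2 (hd s)

end SquareSummable

/-! ### The universal model of weighted shifts -/

section Model

variable {k : ℕ} {n : Fin k → ℕ} {q : ∀ i, MonoidAlgebra ℝ (FreeMonoid (Fin (n i)))}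
  (hq : ∀ i, IsPositiveRegular (q i))

/-- The product `b_α = b_{1,α₁} ⋯ b_{k,α_k}` of the weights. -/
noncomputable def multiWeight (q : ∀ i, MonoidAlgebra ℝ (FreeMonoid (Fin (n i))))
    (α : ∀ i, FreeMonoid (Fin (n i))) : ℝ := ∏ i, weight (q i) (α i)

theorem multiWeight_pos (hq : ∀ i, IsPositiveRegular (q i)) (α : ∀ i, FreeMonoid (Fin (n i))) :
    0 < multiWeight q α :=
  Finset.prod_pos fun i _ => weight_pos (hq i) _

theorem multiWeight_one : multiWeight q 1 = 1 :=
  Finset.prod_eq_one fun i _ => weight_one (q i)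

/-- Left multiplication by `α` on the index set of the model space. -/
def translate (α : ∀ i, FreeMonoid (Fin (n i))) (s : ULift.{v} (∀ i, FreeMonoid (Fin (n i)))) :
    ULift.{v} (∀ i, FreeMonoid (Fin (n i))) := ⟨α * s.down⟩

theorem translate_injective (α : ∀ i, FreeMonoid (Fin (n i))) :
    Function.Injective (translate.{v} α) := fun s t h => by
  have h' : α * s.down = α * t.down := congrArg ULift.down h
  exact ULift.ext _ _ (funext fun i => mul_left_cancel (congrFun h' i))

/-- The weights of the shift by `α`. -/
noncomputable def shiftWeight (q : ∀ i, MonoidAlgebra ℝ (FreeMonoid (Fin (n i))))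
    (α : ∀ i, FreeMonoid (Fin (n i))) (s : ULift.{v} (∀ i, FreeMonoid (Fin (n i)))) : ℝ :=
  √(multiWeight q s.down / multiWeight q (α * s.down))

/-- Boundedness of the shifts: `exists_weight_le` applies in each coordinate. -/
theorem exists_abs_shiftWeight_le (hq : ∀ i, IsPositiveRegular (q i)) (α : ∀ i, FreeMonoid (Fin (n i))) :
    ∃ C, 0 ≤ C ∧ ∀ s, |shiftWeight.{v} q α s| ≤ C := by
  choose C hC h using fun i => exists_weight_le (hq i) (α i)
  refine ⟨√(∏ i, C i), Real.sqrt_nonneg _, fun s => ?_⟩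
  rw [shiftWeight, abs_of_nonneg (Real.sqrt_nonneg _)]
  refine Real.sqrt_le_sqrt ?_
  rw [div_le_iff₀ (multiWeight_pos hq _), multiWeight, multiWeight, ← Finset.prod_mul_distrib]
  exact Finset.prod_le_prod (fun i _ => (weight_pos (hq i) _).le) fun i _ => h i _

/-- The adjoint of the weighted shift by `α`. -/
noncomputable def backShift (α : ∀ i, FreeMonoid (Fin (n i))) :
    SqSum (ULift.{v} (∀ i, FreeMonoid (Fin (n i)))) →L[ℂ]
      SqSum (ULift.{v} (∀ i, FreeMonoid (Fin (n i)))) :=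
  weightedComp (translate_injective α) (exists_abs_shiftWeight_le hq α)

theorem backShift_one : backShift.{v} hq 1 = 1 := by
  refine ContinuousLinearMap.ext fun f => lp.ext (funext fun s => ?_)
  have h1 : shiftWeight q 1 s = 1 := by
    rw [shiftWeight, one_mul, div_self (multiWeight_pos hq _).ne', Real.sqrt_one]
  have h2 : translate 1 s = s := ULift.ext _ _ (one_mul _)
  rw [backShift, weightedComp_apply, h1, h2, Complex.ofReal_one, one_mul]
  rfl

/-- The weights telescope through b_{βs}. The order reverses, so the adjoints are multiplicative. -/
theorem backShift_mul (α β : ∀ i, FreeMonoid (Fin (n i))) :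
    backShift.{v} hq (α * β) = backShift hq β * backShift hq α := by
  refine ContinuousLinearMap.ext fun f => lp.ext (funext fun s => ?_)
  have h1 : shiftWeight q (α * β) s = shiftWeight q β s * shiftWeight q α (translate β s) := by
    rw [shiftWeight, shiftWeight, shiftWeight, ← Real.sqrt_mul
      (div_pos (multiWeight_pos hq _) (multiWeight_pos hq _)).le, mul_assoc]
    congr 1
    rw [translate, div_mul_div_cancel₀ (multiWeight_pos hq _).ne']
  have h2 : translate (α * β) s = translate α (translate β s) := ULift.ext _ _ (mul_assoc _ _ _)
  rw [mul_apply_eq_comp, backShift, backShift, backShift, weightedComp_apply, weightedComp_apply,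
    weightedComp_apply, h1, h2, Complex.ofReal_mul, mul_assoc]

/-- The weighted shifts, as a representation of the product of the free monoids. -/
noncomputable def shift : (∀ i, FreeMonoid (Fin (n i))) →*
    (SqSum (ULift.{v} (∀ i, FreeMonoid (Fin (n i)))) →L[ℂ]
      SqSum (ULift.{v} (∀ i, FreeMonoid (Fin (n i))))) where
  toFun α := star (backShift hq α)
  map_one' := by rw [backShift_one, star_one]
  map_mul' α β := by rw [backShift_mul, star_mul]

theorem star_shift (α : ∀ i, FreeMonoid (Fin (n i))) :
    star (shift.{v} hq α) = backShift hq α := star_star _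

/-- The universal model of the polydomain: the tuple of the weighted shifts by the generators. -/
noncomputable def modelTuple : OpTuple n (SqSum (ULift.{v} (∀ i, FreeMonoid (Fin (n i))))) :=
  fun i j => shift hq (Pi.mulSingle i (FreeMonoid.of j))

theorem evalWord_modelTuple (i : Fin k) (a : FreeMonoid (Fin (n i))) :
    evalWord (modelTuple.{v} hq i) a = shift hq (Pi.mulSingle i a) := by
  induction a using FreeMonoid.recOn with
  | one => rw [evalWord_one, Pi.mulSingle_one, map_one]
  | of_mul j a ih => rw [evalWord_mul, evalWord_of, ih, Pi.mulSingle_mul, map_mul]; rfl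

theorem prod_ofFn_mulSingle (α : ∀ i, FreeMonoid (Fin (n i))) :
    (List.ofFn fun i => (Pi.mulSingle i (α i) : ∀ i, FreeMonoid (Fin (n i)))).prod = α := by
  have key : ∀ (L : List (Fin k)) (j : Fin k), L.Nodup →
      (j ∉ L → (L.map fun i =>
        (Pi.mulSingle i (α i) : ∀ i, FreeMonoid (Fin (n i)))).prod j = 1) ∧
      (j ∈ L → (L.map fun i =>
        (Pi.mulSingle i (α i) : ∀ i, FreeMonoid (Fin (n i)))).prod j = α j) := by
    intro L j hL
    induction L with
    | nil => simp
    | cons i L ih =>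
      rw [List.nodup_cons] at hL
      obtain ⟨ih1, ih2⟩ := ih hL.2
      rw [List.map_cons, List.prod_cons, Pi.mul_apply, List.mem_cons, not_or]
      constructor
      · rintro ⟨hij, hj⟩
        rw [ih1 hj, Pi.mulSingle_eq_of_ne hij, one_mul]
      · intro hj
        by_cases hij : j = i
        · subst hij
          rw [ih1 hL.1, Pi.mulSingle_eq_same, mul_one]
        · rw [ih2 (hj.resolve_left hij), Pi.mulSingle_eq_of_ne hij, one_mul]
  rw [List.ofFn_eq_map]
  exact funext fun j => (key _ j (List.nodup_finRange k)).2 (List.mem_finRange j)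

theorem evalMultiWord_modelTuple (α : ∀ i, FreeMonoid (Fin (n i))) :
    evalMultiWord (modelTuple.{v} hq) α = shift hq α := by
  conv_rhs => rw [← prod_ofFn_mulSingle α]
  rw [map_list_prod, List.map_ofFn, evalMultiWord]
  congr 2
  funext i
  exact evalWord_modelTuple hq i (α i)

theorem CrossCommute.smul {H : Type*} [NormedAddCommGroup H] [InnerProductSpace ℂ H]
    {X : OpTuple n H} (hX : CrossCommute X) (r : ℂ) : CrossCommute (r • X) :=
  fun s t hst a b => ((hX s t hst a b).smul_left r).smul_right r

/-- Elements supported in different coordinates commute in the product monoid, and `shift` is a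
homomorphism on it. -/
theorem crossCommute_modelTuple : CrossCommute (modelTuple.{v} hq) := fun s t hst a b => by
  have h := (Pi.mulSingle_commute (f := fun i => FreeMonoid (Fin (n i))) hst (FreeMonoid.of a)
    (FreeMonoid.of b)).eq
  change shift hq (Pi.mulSingle s (FreeMonoid.of a)) * shift hq (Pi.mulSingle t (FreeMonoid.of b)) =
    shift hq (Pi.mulSingle t (FreeMonoid.of b)) * shift hq (Pi.mulSingle s (FreeMonoid.of a))
  rw [← map_mul, h, map_mul]

open Classical in
/-- The quotient `b_δ / b_β` if `β = α δ`, and `0` if `α` is not a prefix of `β`. -/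
noncomputable def prefixRatio {m : ℕ} (q : MonoidAlgebra ℝ (FreeMonoid (Fin m)))
    (α β : FreeMonoid (Fin m)) : ℝ :=
  if h : ∃ δ, β = α * δ then weight q h.choose / weight q β else 0

theorem prefixRatio_mul {m : ℕ} (q : MonoidAlgebra ℝ (FreeMonoid (Fin m)))
    (α δ : FreeMonoid (Fin m)) : prefixRatio q α (α * δ) = weight q δ / weight q (α * δ) := by
  have h : ∃ δ', α * δ = α * δ' := ⟨δ, rfl⟩
  rw [prefixRatio, dif_pos h, ← mul_left_cancel h.choose_spec]

theorem prefixRatio_of_not {m : ℕ} (q : MonoidAlgebra ℝ (FreeMonoid (Fin m)))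
    {α β : FreeMonoid (Fin m)} (h : ¬ ∃ δ, β = α * δ) : prefixRatio q α β = 0 := dif_neg h

theorem prefixRatio_nonneg {m : ℕ} {q : MonoidAlgebra ℝ (FreeMonoid (Fin m))}
    (hq : IsPositiveRegular q) (α β : FreeMonoid (Fin m)) : 0 ≤ prefixRatio q α β := by
  rw [prefixRatio]
  split_ifs
  · exact div_nonneg (weight_nonneg hq _) (weight_nonneg hq _)
  · exact le_rfl

/-- The diagonal of `Φ(I)` at `r` times the shifts. -/
noncomputable def phiDiag {m : ℕ} (q : MonoidAlgebra ℝ (FreeMonoid (Fin m))) (r : ℝ)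
    (β : FreeMonoid (Fin m)) : ℝ :=
  ∑ α ∈ q.coeff.support, q.coeff α * ((r ^ α.length) ^ 2 * prefixRatio q α β)

/-- For r = 1 the recursion says that the terms a_α b_δ over the prefixes α of β add up to at most
b_β; each term then gains r^(2|α|) ≤ r². -/
theorem phiDiag_le {m : ℕ} {q : MonoidAlgebra ℝ (FreeMonoid (Fin m))}
    (hq : IsPositiveRegular q) {r : ℝ} (hr0 : 0 ≤ r) (hr1 : r ≤ 1) (β : FreeMonoid (Fin m)) :
    phiDiag q r β ≤ r ^ 2 := by
  have hβ := weight_pos hq β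
  have h := sum_coeff_mul_weight_le hq β q.coeff.support
    (fun α => q.coeff α * (prefixRatio q α β * weight q β))
    (fun α δ hδ => by
      subst hδ; rw [prefixRatio_mul, div_mul_cancel₀ _ hβ.ne'])
    (fun α hα => by rw [prefixRatio_of_not q hα, zero_mul, mul_zero])
  simp only [← mul_assoc] at h
  rw [← Finset.sum_mul] at h
  have h1 := le_of_mul_le_mul_right (h.trans_eq (one_mul _).symm) hβ
  calc phiDiag q r β ≤ ∑ α ∈ q.coeff.support, r ^ 2 * (q.coeff α * prefixRatio q α β) := by
        refine Finset.sum_le_sum fun α hα => ?_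
        have hlen : 1 ≤ α.length := by
          rw [Nat.one_le_iff_ne_zero]
          intro h
          rw [FreeMonoid.length_eq_zero.1 h] at hα
          exact Finsupp.mem_support_iff.1 hα hq.const_eq_zero
        rw [mul_left_comm]
        have := mul_nonneg (hq.nonneg α) (prefixRatio_nonneg hq α β)
        gcongr
        exact (pow_le_pow_of_le_one hr0 hr1 hlen).trans_eq (pow_one r)
    _ = r ^ 2 * ∑ α ∈ q.coeff.support, q.coeff α * prefixRatio q α β := by rw [Finset.mul_sum]
    _ ≤ r ^ 2 := mul_le_of_le_one_right (sq_nonneg r) h1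

/-- The shift moves only the i-th coordinate, so the weights of the other coordinates cancel.
Invariance of d under this move lets its value be read at the target instead of the source. -/
theorem isDiag_shift_conj (i : Fin k) (a : FreeMonoid (Fin (n i)))
    {T : SqSum (ULift.{v} (∀ i, FreeMonoid (Fin (n i)))) →L[ℂ]
      SqSum (ULift.{v} (∀ i, FreeMonoid (Fin (n i))))}
    {d : ULift.{v} (∀ i, FreeMonoid (Fin (n i))) → ℝ} (hT : IsDiag T d)
    (hd : ∀ s, d (translate (Pi.mulSingle i a) s) = d s) :
    IsDiag (shift hq (Pi.mulSingle i a) * T * star (shift hq (Pi.mulSingle i a)))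
      fun t => prefixRatio (q i) a (t.down i) * d t := by
  rw [star_shift]
  refine hT.conj (translate_injective _) (exists_abs_shiftWeight_le hq _) (fun s => ?_)
    (fun t ht => ?_)
  · rw [hd]
    congr 1
    rw [shiftWeight, Real.sq_sqrt (div_pos (multiWeight_pos hq _) (multiWeight_pos hq _)).le]
    change prefixRatio (q i) a ((Pi.mulSingle i a * s.down : ∀ i, FreeMonoid (Fin (n i))) i) = _
    rw [Pi.mul_apply, Pi.mulSingle_eq_same, prefixRatio_mul, multiWeight, multiWeight,
      ← Finset.prod_div_distrib, Finset.prod_eq_single i]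
    · rw [Pi.mul_apply, Pi.mulSingle_eq_same]
    · intro j _ hj
      rw [Pi.mul_apply, Pi.mulSingle_eq_of_ne hj, one_mul, div_self (weight_pos (hq j) _).ne']
    · intro h; exact absurd (Finset.mem_univ i) h
  · rw [prefixRatio_of_not, zero_mul]
    rintro ⟨δ, hδ⟩
    refine ht ⟨⟨Function.update t.down i δ⟩, ULift.ext _ _ (funext fun j => ?_)⟩
    change (Pi.mulSingle i a * Function.update t.down i δ : ∀ i, FreeMonoid (Fin (n i))) j = _
    by_cases hj : j = i
    · subst hj
      rw [Pi.mul_apply, Pi.mulSingle_eq_same, Function.update_self, hδ]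
    · rw [Pi.mul_apply, Pi.mulSingle_eq_of_ne hj, one_mul, Function.update_of_ne hj]

theorem isDiag_Phi_modelTuple (r : ℝ) (i : Fin k)
    {T : SqSum (ULift.{v} (∀ i, FreeMonoid (Fin (n i)))) →L[ℂ]
      SqSum (ULift.{v} (∀ i, FreeMonoid (Fin (n i))))}
    {d : ULift.{v} (∀ i, FreeMonoid (Fin (n i))) → ℝ} (hT : IsDiag T d)
    (hd : ∀ a s, d (translate (Pi.mulSingle i a) s) = d s) :
    IsDiag (Phi (q i) (((r : ℂ) • modelTuple hq) i) T)
      fun t => phiDiag (q i) r (t.down i) * d t := by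
  rw [Phi_apply]
  have h := IsDiag.sum (q i).coeff.support fun a _ =>
    (((isDiag_shift_conj hq i a hT (hd a)).smul ((r ^ a.length) ^ 2)).smul ((q i).coeff a))
  have e1 : (fun t : ULift.{v} (∀ i, FreeMonoid (Fin (n i))) =>
      phiDiag (q i) r (t.down i) * d t) = fun t => ∑ a ∈ (q i).coeff.support,
        (q i).coeff a * ((r ^ a.length) ^ 2 * (prefixRatio (q i) a (t.down i) * d t)) := by
    funext t
    rw [phiDiag, Finset.sum_mul]
    exact Finset.sum_congr rfl fun a _ => by ring
  rw [e1]
  convert h using 2 with a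
  rw [Pi.smul_apply, evalWord_smul, evalWord_modelTuple, star_smul, smul_mul_assoc, smul_mul_assoc,
    mul_smul_comm, ← starRingEnd_apply, ← Complex.ofReal_pow, Complex.conj_ofReal,
    smul_smul ((r ^ a.length : ℝ) : ℂ), ← Complex.ofReal_mul, ← sq]

theorem isDiag_defect_modelTuple (r : ℝ) {p : Fin k → ℕ} (hp : ∀ i, p i ≤ 1) :
    IsDiag (defect q ((r : ℂ) • modelTuple.{v} hq) p 1) fun t =>
      ((List.finRange k).map fun i => (1 - phiDiag (q i) r (t.down i)) ^ p i).prod := by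
  rw [defect, List.ofFn_eq_map]
  have key : ∀ L : List (Fin k), L.Nodup →
      IsDiag ((L.map fun i => (1 - Phi (q i) (((r : ℂ) • modelTuple.{v} hq) i)) ^ p i).prod 1)
        fun t => (L.map fun i => (1 - phiDiag (q i) r (t.down i)) ^ p i).prod := by
    intro L hL
    induction L with
    | nil => exact isDiag_one
    | cons i L ih =>
      rw [List.nodup_cons] at hL
      have hT := ih hL.2
      simp only [List.map_cons, List.prod_cons]
      rcases Nat.le_one_iff_eq_zero_or_eq_one.1 (hp i) with h | h
      · simpa only [h, pow_zero, one_mul] using hT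
      · simp only [h, pow_one, sub_mul, one_mul]
        -- The diagonal built so far involves only the coordinates in L, and i is not among them;
        -- this is the required invariance.
        refine hT.sub (isDiag_Phi_modelTuple hq r i hT fun a s => ?_)
        refine congrArg List.prod (List.map_congr_left fun j hj => ?_)
        have hji : j ≠ i := fun h => hL.1 (h ▸ hj)
        have : (translate (Pi.mulSingle i a) s).down j = s.down j := by
          change (Pi.mulSingle i a * s.down : ∀ i, FreeMonoid (Fin (n i))) j = _
          rw [Pi.mul_apply, Pi.mulSingle_eq_of_ne hji, one_mul]
        rw [this]
  exact key _ (List.nodup_finRange k)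

/-- The multiples of the model of ratio less than `1` belong to the open polydomain. -/
theorem smul_modelTuple_mem_openPolydomain {r : ℝ} (hr0 : 0 ≤ r) (hr1 : r < 1) :
    (r : ℂ) • modelTuple.{v} hq ∈
      openPolydomain q (SqSum (ULift.{v} (∀ i, FreeMonoid (Fin (n i))))) := by
  -- This makes every defect diagonal nonnegative, and the full one at least (1 - r²)^k.
  have hle : ∀ i β, 1 - r ^ 2 ≤ 1 - phiDiag (q i) r β := fun i β =>
    sub_le_sub_left (phiDiag_le (hq i) hr0 hr1.le β) 1
  have hpos : 0 < 1 - r ^ 2 := by nlinarith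
  refine ⟨⟨(crossCommute_modelTuple hq).smul _, fun p hp => ?_⟩, ?_⟩
  · refine (isDiag_defect_modelTuple hq r hp).isPositive fun t => List.prod_nonneg fun x hx => ?_
    obtain ⟨i, -, rfl⟩ := List.mem_map.1 hx
    exact pow_nonneg (hpos.le.trans (hle i _)) _
  · refine (isDiag_defect_modelTuple hq r fun _ => le_rfl).isUnit (pow_pos hpos k) fun t => ?_
    have : ∀ L : List (Fin k), (1 - r ^ 2) ^ L.length ≤
        (L.map fun i => (1 - phiDiag (q i) r (t.down i)) ^ 1).prod := by
      intro L
      induction L with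
      | nil => simp
      | cons i L ih =>
        rw [List.map_cons, List.prod_cons, List.length_cons, pow_succ', pow_one]
        exact mul_le_mul (hle i _) ih (pow_nonneg hpos.le _) (hpos.le.trans (hle i _))
    simpa using this (List.finRange k)

open Classical in
-- The empty word has weight 1, so the shift weight at it is √(1/b_α): this is how 1/b_α enters the
-- Gram operator.
theorem shift_single_one (α : ∀ i, FreeMonoid (Fin (n i))) :
    shift.{v} hq α (lp.single 2 ⟨1⟩ (1 : ℂ)) =
      ((√(multiWeight q α)⁻¹ : ℝ) : ℂ) • (lp.single 2 ⟨α⟩ (1 : ℂ) : SqSum _) := by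
  refine lp.ext (funext fun t => ?_)
  rw [lp.coeFn_smul, Pi.smul_apply, lp.single_apply, smul_eq_mul]
  change (star (backShift hq α)) _ t = _
  by_cases ht : t ∈ Set.range (translate.{v} α)
  · obtain ⟨s, rfl⟩ := ht
    rw [backShift, adjoint_weightedComp_apply, lp.single_apply]
    by_cases hs : s = ⟨1⟩
    · subst hs
      have h1 : translate α ⟨1⟩ = (⟨α⟩ : ULift.{v} (∀ i, FreeMonoid (Fin (n i)))) :=
        ULift.ext _ _ (mul_one α)
      rw [h1, Pi.single_eq_same, Pi.single_eq_same, shiftWeight, mul_one α, multiWeight_one,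
        one_div]
    · have h1 : translate α s ≠ ⟨α⟩ := fun h => hs (translate_injective α
        (h.trans (ULift.ext _ _ (mul_one α).symm)))
      rw [Pi.single_eq_of_ne hs, Pi.single_eq_of_ne h1, mul_zero, mul_zero]
  · have h1 : t ≠ ⟨α⟩ := fun h => ht ⟨⟨1⟩, (ULift.ext _ _ (mul_one α)).trans h.symm⟩
    rw [backShift, adjoint_weightedComp_apply_of_notMem _ _ _ _ ht, Pi.single_eq_of_ne h1, mul_zero]

end Model

/-! ### Divergence at multiples of the model -/

section Divergence

theorem norm_sum_tmul_orthonormal_sq {K H : Type*} [NormedAddCommGroup K] [InnerProductSpace ℂ K]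
    [NormedAddCommGroup H] [InnerProductSpace ℂ H] {ι : Type*} {e : ι → H} (he : Orthonormal ℂ e)
    (F : Finset ι) (y : ι → K) :
    ‖(∑ i ∈ F, y i ⊗ₜ[ℂ] e i : K ⊗[ℂ] H)‖ ^ 2 = ∑ i ∈ F, ‖y i‖ ^ 2 := by
  classical
  have h : (inner ℂ (∑ i ∈ F, y i ⊗ₜ[ℂ] e i : K ⊗[ℂ] H) (∑ i ∈ F, y i ⊗ₜ[ℂ] e i) : ℂ) =
      ((∑ i ∈ F, ‖y i‖ ^ 2 : ℝ) : ℂ) := by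
    rw [sum_inner, Complex.ofReal_sum]
    refine Finset.sum_congr rfl fun i hi => ?_
    rw [inner_sum, Finset.sum_eq_single_of_mem i hi]
    · rw [TensorProduct.inner_tmul, inner_self_eq_norm_sq_to_K, inner_self_eq_norm_sq_to_K, he.1 i]
      simp
    · intro j _ hj
      rw [TensorProduct.inner_tmul, he.2 hj.symm, mul_zero]
  exact ((inner_self_eq_norm_sq (𝕜 := ℂ) (∑ i ∈ F, y i ⊗ₜ[ℂ] e i : K ⊗[ℂ] H)).symm.trans
    (congrArg RCLike.re h)).trans (Complex.ofReal_re _)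

variable {K : Type u} [NormedAddCommGroup K] [InnerProductSpace ℂ K] [CompleteSpace K]
  {k : ℕ} {n : Fin k → ℕ} {q : ∀ i, MonoidAlgebra ℝ (FreeMonoid (Fin (n i)))}
  (hq : ∀ i, IsPositiveRegular (q i)) (A : (∀ i, FreeMonoid (Fin (n i))) → (K →L[ℂ] K))

open Classical in
/-- The standard orthonormal family of the model space. -/
noncomputable def modelBasis (n : Fin k → ℕ) (α : ∀ i, FreeMonoid (Fin (n i))) :
    SqSum (ULift.{v} (∀ i, FreeMonoid (Fin (n i)))) := lp.single 2 ⟨α⟩ (1 : ℂ)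

theorem orthonormal_modelBasis : Orthonormal ℂ (modelBasis.{v} n) := by
  classical
  rw [orthonormal_iff_ite]
  intro α β
  rw [modelBasis, modelBasis, lp.inner_single_left, lp.single_apply]
  by_cases h : α = β
  · subst h; simp
  · rw [if_neg h, Pi.single_eq_of_ne (fun h' => h (congrArg ULift.down h')), inner_zero_right]

omit [CompleteSpace K] in
theorem homogeneousPart_modelTuple_apply (s : ℝ) (p : Fin k → ℕ) (x : K) :
    homogeneousPart A ((s : ℂ) • modelTuple.{v} hq) p
        ((x ⊗ₜ[ℂ] modelBasis n 1 : K ⊗[ℂ] _) : HilbertTensor K _) =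
      ((∑ α ∈ multiWords n p,
        (((s ^ (∑ i, (α i).length) * √(multiWeight q α)⁻¹ : ℝ) : ℂ) • A α x) ⊗ₜ[ℂ] modelBasis n α :
          K ⊗[ℂ] _) : HilbertTensor K _) := by
  rw [homogeneousPart, sum_apply, coe_finset_sum]
  refine Finset.sum_congr rfl fun α _ => ?_
  rw [opTensor_tmul, evalMultiWord_smul, evalMultiWord_modelTuple, smul_apply]
  have h : shift hq α (modelBasis.{v} n 1) =
      ((√(multiWeight q α)⁻¹ : ℝ) : ℂ) • modelBasis.{v} n α := shift_single_one hq α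
  rw [h, smul_smul, ← Complex.ofReal_pow, ← Complex.ofReal_mul, TensorProduct.tmul_smul,
    TensorProduct.smul_tmul']

theorem opNorm_apply_sq_le {E : Type*} [NormedAddCommGroup E] [NormedSpace ℂ E]
    (T : E →L[ℂ] E) (z : E) : ‖T z‖ ^ 2 ≤ ‖T‖ ^ 2 * ‖z‖ ^ 2 := by
  rw [← mul_pow]
  exact pow_le_pow_left₀ (norm_nonneg _) (T.le_opNorm z) 2

/-- The partial sums of the series at a multiple of the model dominate the Gram operators of the
coefficients. -/
theorem norm_coeffGram_le {s : ℝ} (hs : 0 < s) {F : Finset (Fin k → ℕ)} {p : Fin k → ℕ}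
    (hp : p ∈ F) : ‖coeffGram q A p‖ ≤
      ‖∑ p ∈ F, homogeneousPart A ((s : ℂ) • modelTuple.{v} hq) p‖ ^ 2 / (s ^ (∑ i, p i)) ^ 2 := by
  classical
  refine norm_sum_star_mul_self_le (multiWords n p) (fun α => (multiWeight q α)⁻¹)
    (fun α => inv_nonneg.2 (multiWeight_pos hq α).le) A (by positivity) fun x => ?_
  rw [div_mul_eq_mul_div, le_div_iff₀ (by positivity)]
  have h1 := opNorm_apply_sq_le
    (∑ p ∈ F, homogeneousPart A ((s : ℂ) • modelTuple.{v} hq) p)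
    ((x ⊗ₜ[ℂ] modelBasis n 1 : K ⊗[ℂ] _) : HilbertTensor K _)
  rw [UniformSpace.Completion.norm_coe, TensorProduct.norm_tmul, orthonormal_modelBasis.1,
    mul_one] at h1
  refine le_trans ?_ h1
  -- Different multidegrees involve different basis vectors, so Pythagoras isolates the contribution
  -- of p and nothing cancels.
  have hdisj : (F : Set (Fin k → ℕ)).PairwiseDisjoint (multiWords n) := by
    intro p _ p' _ hpp'
    refine Finset.disjoint_left.2 fun α h h' => hpp' (funext fun i => ?_)
    rw [← mem_multiWords.1 h i, mem_multiWords.1 h' i]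
  rw [sum_apply, Finset.sum_congr rfl fun p _ => homogeneousPart_modelTuple_apply hq A s p x,
    ← coe_finset_sum, ← Finset.sum_biUnion hdisj, UniformSpace.Completion.norm_coe,
    norm_sum_tmul_orthonormal_sq orthonormal_modelBasis, Finset.sum_biUnion hdisj]
  refine le_trans (le_of_eq ?_)
    (Finset.single_le_sum (fun p _ => Finset.sum_nonneg fun α _ => sq_nonneg _) hp)
  rw [Finset.sum_mul]
  refine Finset.sum_congr rfl fun α hα => ?_
  rw [norm_smul, Complex.norm_real, Real.norm_of_nonneg (by positivity), mul_pow, mul_pow,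
    Real.sq_sqrt (inv_nonneg.2 (multiWeight_pos hq α).le),
    Finset.sum_congr rfl fun i _ => mem_multiWords.1 hα i]
  ring

theorem eventually_opNorm_le {E : Type*} [NormedAddCommGroup E] [NormedSpace ℂ E]
    {S : ℕ → E →L[ℂ] E} {T : E →L[ℂ] E} (h : Filter.Tendsto S Filter.atTop (nhds T)) :
    ∀ᶠ N in Filter.atTop, ‖S N‖ ≤ ‖T‖ + 1 :=
  h.norm.eventually_le_const (lt_add_one _)

/-- Geometric bounds on the coefficients bound the inverse of the radius of convergence. -/
theorem le_of_forall_le_div_pow {g : (Fin k → ℕ) → ℝ} (hg : ∀ p, 0 ≤ g p) {γ : ℝ≥0∞}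
    (hγ : γ⁻¹ = Filter.limsup (fun p : Fin k → ℕ => ENNReal.ofReal
        (g p ^ (1 / (2 * ((∑ i, p i : ℕ) : ℝ))))) Filter.cofinite)
    {C : ℝ} (hC : 0 < C) {s : ℝ≥0} (h : ∀ p, g p ≤ C ^ 2 / ((s : ℝ) ^ (∑ i, p i)) ^ 2) :
    (s : ℝ≥0∞) ≤ γ := by
  by_contra! hlt
  obtain ⟨t, hγt, hts⟩ := ENNReal.lt_iff_exists_nnreal_btwn.1 hlt
  rw [ENNReal.coe_lt_coe] at hts
  have ht : 0 < t := by exact_mod_cast pos_of_gt hγt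
  have ht' : (0 : ℝ) < t := NNReal.coe_pos.2 ht
  have hs' : (0 : ℝ) < s := ht'.trans (NNReal.coe_lt_coe.2 hts)
  -- With γ < t < s the constant is absorbed: C (t/s)^|p| < 1 for all but finitely many p, so g p ≤
  -- t^(-2|p|).
  have hlim := (summable_pow_sum (t := (t / s : ℝ)) (by positivity)
    ((div_lt_one hs').2 (NNReal.coe_lt_coe.2 hts)) k).tendsto_cofinite_zero
  have hle : Filter.limsup (fun p : Fin k → ℕ => ENNReal.ofReal
      (g p ^ (1 / (2 * ((∑ i, p i : ℕ) : ℝ))))) Filter.cofinite ≤ (t : ℝ≥0∞)⁻¹ := by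
    refine Filter.limsup_le_of_le (by isBoundedDefault) ?_
    filter_upwards [hlim.eventually_lt_const (show (0 : ℝ) < 1 / C by positivity),
      (Set.finite_singleton (0 : Fin k → ℕ)).compl_mem_cofinite] with p hp hp0
    have hN : ∑ i, p i ≠ 0 := fun h => hp0 (funext fun i =>
      Finset.sum_eq_zero_iff.1 h i (Finset.mem_univ i))
    have hgp := h p
    set N := ∑ i, p i with hNdef
    have hN' : (N : ℝ) ≠ 0 := Nat.cast_ne_zero.2 hN
    have h1 : g p ≤ ((t : ℝ)⁻¹) ^ (2 * N) := by
      refine hgp.trans ?_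
      rw [div_pow, div_lt_div_iff₀ (by positivity) hC, one_mul, mul_comm] at hp
      rw [inv_pow, mul_comm 2 N, pow_mul, ← one_div, div_le_div_iff₀ (by positivity) (by positivity),
        one_mul, ← mul_pow]
      exact pow_le_pow_left₀ (by positivity) hp.le 2
    rw [← ENNReal.coe_inv ht.ne', ENNReal.ofReal, ENNReal.coe_le_coe, Real.toNNReal_le_iff_le_coe,
      NNReal.coe_inv]
    calc g p ^ (1 / (2 * (N : ℝ))) ≤ (((t : ℝ)⁻¹) ^ (2 * N)) ^ (1 / (2 * (N : ℝ))) :=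
          Real.rpow_le_rpow (hg p) h1 (by positivity)
      _ = (t : ℝ)⁻¹ := by
          rw [← Real.rpow_natCast, ← Real.rpow_mul (by positivity)]
          push_cast
          rw [mul_one_div_cancel (by positivity), Real.rpow_one]
  rw [← hγ, ENNReal.inv_le_inv] at hle
  exact absurd hγt (not_lt.2 hle)

/-- Each p lies in F_N for some N at which the partial sum has norm at most ‖T‖ + 1. This bounds all
Gram operators with one constant and forces s ≤ γ. -/
theorem not_tendsto_sum_homogeneousPart_modelTuple {γ : ℝ≥0∞}
    (hγ : γ⁻¹ = Filter.limsup
      (fun p : Fin k → ℕ => ENNReal.ofReal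
        (‖coeffGram q A p‖ ^ (1 / (2 * ((∑ i, p i : ℕ) : ℝ))))) Filter.cofinite)
    {s : ℝ≥0} (hs : γ < (s : ℝ≥0∞)) {F : ℕ → Finset (Fin k → ℕ)}
    (hF : Filter.Tendsto F Filter.atTop Filter.atTop)
    (T : HilbertTensor K (SqSum (ULift.{v} (∀ i, FreeMonoid (Fin (n i))))) →L[ℂ]
      HilbertTensor K (SqSum (ULift.{v} (∀ i, FreeMonoid (Fin (n i)))))) :
    ¬ Filter.Tendsto (fun N => ∑ p ∈ F N,
      homogeneousPart A (((s : ℝ) : ℂ) • modelTuple.{v} hq) p) Filter.atTop (nhds T) := by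
  intro hT
  have hs0 : (0 : ℝ) < s := by
    have : (0 : ℝ≥0∞) < s := pos_of_gt hs
    exact_mod_cast this
  have hT0 : 0 ≤ ‖T‖ := opNorm_nonneg T
  refine absurd (le_of_forall_le_div_pow (fun _ => norm_nonneg _) hγ (C := ‖T‖ + 1) (by linarith)
    (s := s) fun p => ?_) (not_le.2 hs)
  obtain ⟨N, hN, hpN⟩ := ((eventually_opNorm_le hT).and
    (hF.eventually (Filter.eventually_ge_atTop {p}))).exists
  refine (norm_coeffGram_le hq A hs0 (hpN (Finset.mem_singleton_self p))).trans ?_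
  gcongr

end Divergence

end Polydomain

/-! ### The Hadamard formula -/

theorem mainTheorem6 {k : ℕ} (hk : 1 ≤ k) (n : Fin k → ℕ) (hn : ∀ i, 1 ≤ n i)
    (q : ∀ i, MonoidAlgebra ℝ (FreeMonoid (Fin (n i))))
    (hq : ∀ i, Polydomain.IsPositiveRegular (q i))
    {K : Type u} [NormedAddCommGroup K] [InnerProductSpace ℂ K] [CompleteSpace K]
    (A : (∀ i, FreeMonoid (Fin (n i))) → (K →L[ℂ] K)) (γ : ℝ≥0∞)
    (hγ : γ⁻¹ = Filter.limsup
      (fun p : Fin k → ℕ => ENNReal.ofReal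
        (‖Polydomain.coeffGram q A p‖ ^ (1 / (2 * ((∑ i, p i : ℕ) : ℝ))))) Filter.cofinite) :
    (∀ (H : Type v) [NormedAddCommGroup H] [InnerProductSpace ℂ H] [CompleteSpace H],
      (∀ X ∈ Polydomain.polydomainOfRadius q H γ,
        Summable fun p : Fin k → ℕ => ‖Polydomain.homogeneousPart A X p‖) ∧
      (∀ r : ℝ≥0, (r : ℝ≥0∞) < γ →
        SummableUniformlyOn
          (fun (p : Fin k → ℕ) (X : Polydomain.OpTuple n H) => ‖Polydomain.homogeneousPart A X p‖)
          (((r : ℝ) : ℂ) • closure (Polydomain.openPolydomain q H)))) ∧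
    (∀ s : ℝ≥0, γ < (s : ℝ≥0∞) →
      ∃ (H : Type v) (_ : NormedAddCommGroup H) (_ : InnerProductSpace ℂ H) (_ : CompleteSpace H),
        ∃ Y ∈ (((s : ℝ) : ℂ) • closure (Polydomain.openPolydomain q H) :
            Set (Polydomain.OpTuple n H)),
          ∀ F : ℕ → Finset (Fin k → ℕ), Filter.Tendsto F Filter.atTop Filter.atTop →
            ¬ ∃ T : Polydomain.HilbertTensor K H →L[ℂ] Polydomain.HilbertTensor K H,
              Filter.Tendsto (fun N => ∑ p ∈ F N, Polydomain.homogeneousPart A Y p)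
                Filter.atTop (nhds T)) := by
  refine ⟨fun H _ _ _ => ⟨fun X hX => Polydomain.summable_homogeneousPart hq A hγ hX,
    fun r hr => Polydomain.summableUniformlyOn_homogeneousPart hq A hγ hr⟩, fun s hs => ?_⟩
  -- The point Y is t times the model with γ < t < s: as s·(t/s) times the model it lies in s times
  -- the open polydomain, and t > γ still gives divergence.
  obtain ⟨t, hγt, hts⟩ := ENNReal.lt_iff_exists_nnreal_btwn.1 hs
  rw [ENNReal.coe_lt_coe, ← NNReal.coe_lt_coe] at hts
  have hs0 : (0 : ℝ) < s := (NNReal.coe_nonneg t).trans_lt hts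
  refine ⟨Polydomain.SqSum (ULift.{v} (∀ i, FreeMonoid (Fin (n i)))), inferInstance, inferInstance,
    inferInstance, ((t : ℝ) : ℂ) • Polydomain.modelTuple hq, ?_, fun F hF ⟨T, hT⟩ =>
      Polydomain.not_tendsto_sum_homogeneousPart_modelTuple hq A hγ hγt hF T hT⟩
  refine ⟨((t / s : ℝ) : ℂ) • Polydomain.modelTuple hq, subset_closure
    (Polydomain.smul_modelTuple_mem_openPolydomain hq (by positivity) ((div_lt_one hs0).2 hts)), ?_⟩
  change ((s : ℝ) : ℂ) • ((t / s : ℝ) : ℂ) • Polydomain.modelTuple hq = _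
  rw [smul_smul, ← Complex.ofReal_mul, mul_div_cancel₀ _ hs0.ne']
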